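/- **Theorem 3.1.** Let $\mathcal K\subset\mathbb R^3$ be strictly star-shaped with respect to the origin, i.e. $\mathcal K=\{r\omega:\ \omega\in S^2,\ 0\le r\le\phi(\omega)\}$ for some smooth positive function $\phi$ on $S^2$. Let $\mathcal P:\mathbb R\times\mathbb R^3\to(-\pi,\pi)\times S^3$ be the Penrose map, $\mathcal P(t,r\omega)=(T,(\cos R,\sin R\,\omega))$ with $$T=\arctan(t+r)+\arctan(t-r),\qquad R=\arctan(t+r)-\arctan(t-r)\qquad (r\ge 0,\ \omega\in S^2),$$ where $S^3=\{X\in\mathbb R^4:|X|=1\}$. Put $\mathcal K_*=\mathcal P([0,\infty)\times\mathcal K)$, $Y=([0,\pi)\times S^3)\setminus\mathcal K_*$ and $Y_T=\{X\in S^3:(T,X)\in Y\}$, and let $\partial Y$ be the boundary of $Y$ in $[0,\pi)\times S^3$. Let $g$ be the standard metric on $S^3$, $\Delta_g$ its Laplace–Beltrami operator, $\square_g=\partial_T^2-\Delta_g$, and $|u'|^2=|\partial_Tu|^2+\|\mathrm{grad}_g u\|_g^2$. Suppose that the real-valued function $u$ is $C^2$ on $Y\cup\partial Y$, that $u(T,X)=0$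 for all $(T,X)\in\partial Y$, and let $F=\square_g u$ in $Y$. Then, for $0<T<\pi$, $$\|u'(T,\cdot)\|_{L^2(Y_T)}\le\|u'(0,\cdot)\|_{L^2(Y_0)}+\int_0^T\|F(S,\cdot)\|_{L^2(Y_S)}\,dS,$$ where the $L^2$ norms are taken with respect to the volume element of $g$. -/

import Mathlib

open Set MeasureTheory
open scoped Manifold ContDiff ENNReal

noncomputable section

namespace EinsteinDiamond

/-- Euclidean `ℝ³` and `ℝ⁴`. -/
abbrev E3 : Type := EuclideanSpace ℝ (Fin 3)

abbrev E4 : Type := EuclideanSpace ℝ (Fin 4)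

/-- The unit spheres `S² ⊆ ℝ³` and `S³ ⊆ ℝ⁴`, with Mathlib's smooth structure. -/
abbrev S2 : Type := Metric.sphere (0 : E3) 1

abbrev S3 : Type := Metric.sphere (0 : E4) 1

instance factFinrankE3 : Fact (Module.finrank ℝ E3 = 2 + 1) := ⟨by simp⟩

instance factFinrankE4 : Fact (Module.finrank ℝ E4 = 3 + 1) := ⟨by simp⟩

/-- `K ⊆ ℝ³` is (smooth and) strictly star-shaped with respect to the origin: in polar coordinates
`K = {r θ : 0 ≤ r ≤ φ(θ)}` for a smooth positive function `φ` on `S²`. -/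
def StrictlyStarShaped (K : Set E3) : Prop :=
  ∃ φ : S2 → ℝ, ContMDiff (𝓡 2) 𝓘(ℝ, ℝ) ∞ φ ∧ (∀ θ, 0 < φ θ) ∧
    K = {x | ∃ (r : ℝ) (θ : S2), 0 ≤ r ∧ r ≤ φ θ ∧ x = r • (θ : E3)}

/-- The point `(cos R, (sin R) x / |x|)` of `S³`, at distance `R` (for `0 ≤ R ≤ π`) from the north
pole `(1, 0, 0, 0)`, in the direction of `x ≠ 0`. It is used at `x = 0` only with `R = 0`, and then
it has to be the north pole; the value at `x = 0` is therefore set to be the north pole. -/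
def polarPoint (R : ℝ) (x : E3) : S3 :=
  if hx : x = 0 then ⟨!₂[1, 0, 0, 0], by simp [EuclideanSpace.norm_eq, Fin.sum_univ_four]⟩
  else
    ⟨!₂[Real.cos R, Real.sin R * (x 0 / ‖x‖), Real.sin R * (x 1 / ‖x‖), Real.sin R * (x 2 / ‖x‖)], by
      have h0 : ‖x‖ ≠ 0 := norm_ne_zero_iff.mpr hx
      have h1 : ‖x‖ ^ 2 = x 0 ^ 2 + x 1 ^ 2 + x 2 ^ 2 := by
        rw [EuclideanSpace.real_norm_sq_eq, Fin.sum_univ_three]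
      have h2 : (x 0 / ‖x‖) ^ 2 + (x 1 / ‖x‖) ^ 2 + (x 2 / ‖x‖) ^ 2 = 1 := by
        rw [div_pow, div_pow, div_pow, ← add_div, ← add_div, ← h1]
        exact div_self (pow_ne_zero 2 h0)
      rw [mem_sphere_zero_iff_norm, ← sq_eq_sq₀ (norm_nonneg _) zero_le_one,
        EuclideanSpace.real_norm_sq_eq, Fin.sum_univ_four]
      simp only [Matrix.cons_val]
      linear_combination Real.sin R ^ 2 * h2 + Real.sin_sq_add_cos_sq R⟩

/-- Penrose's conformal compactification `𝒫 : ℝ × ℝ³ → ℝ × S³`: with `r = |x|`,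
`T = arctan (t + r) + arctan (t - r)`, `R = arctan (t + r) - arctan (t - r)`, and the angular
variable is preserved. -/
def penrose (p : ℝ × E3) : ℝ × S3 :=
  (Real.arctan (p.1 + ‖p.2‖) + Real.arctan (p.1 - ‖p.2‖),
    polarPoint (Real.arctan (p.1 + ‖p.2‖) - Real.arctan (p.1 - ‖p.2‖)) p.2)

/-- The slab `[0, π) × S³`. -/
def slab : Set (ℝ × S3) := Ico 0 Real.pi ×ˢ univ

/-- The transformed obstacle `𝒦_* = 𝒫([0, ∞) × K)`. -/
def transformedObstacle (K : Set E3) : Set (ℝ × S3) := penrose '' (Ici 0 ×ˢ K)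

/-- `Y = ([0, π) × S³) \ 𝒦_*`. -/
def exterior (K : Set E3) : Set (ℝ × S3) := slab \ transformedObstacle K

/-- The cross section `Y_T = {X ∈ S³ : (T, X) ∈ Y}`. -/
def exteriorSlice (K : Set E3) (T : ℝ) : Set S3 := {X | (T, X) ∈ exterior K}

/-- The closure of `Y` in `[0, π) × S³`. -/
def exteriorClosure (K : Set E3) : Set (ℝ × S3) := closure (exterior K) ∩ slab

/-- The (lateral) boundary `∂Y`: the boundary of the relatively open set `Y` in `[0, π) × S³`. -/
def exteriorBoundary (K : Set E3) : Set (ℝ × S3) := exteriorClosure K \ exterior K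

/-- The radial projection `x ↦ x / |x|` of `ℝ⁴ \ {0}` onto `S³` (the value at `0` plays no role). -/
def radialProj (x : E4) : S3 :=
  if hx : x = 0 then ⟨!₂[1, 0, 0, 0], by simp [EuclideanSpace.norm_eq, Fin.sum_univ_four]⟩
  else ⟨‖x‖⁻¹ • x, by simp [norm_smul, hx]⟩

/-- The gradient of `f : S³ → ℝ` for the standard metric `g` on `S³`. As `g` is induced by the
embedding in `ℝ⁴`, this is the tangential gradient in `X^⊥ ⊆ ℝ⁴`, that is, the Euclidean gradient at
`X` of the extension `x ↦ f (x / |x|)`, which is constant along the normal direction. Its `g`-length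
is its length in `ℝ⁴`. -/
def sphereGrad (f : S3 → ℝ) (X : S3) : E4 :=
  gradient (fun x : E4 => f (radialProj x)) (X : E4)

/-- The Laplace–Beltrami operator `Δ_g` of the standard metric on `S³`, as the Euclidean Laplacian
of the extension of `f` that is homogeneous of degree zero. -/
def sphereLaplacian (f : S3 → ℝ) (X : S3) : ℝ :=
  Laplacian.laplacian (fun x : E4 => f (radialProj x)) (X : E4)

/-- `∂_T u` on `[0, ∞) × S³` (a one-sided derivative at `T = 0`). -/
def timeDeriv (u : ℝ × S3 → ℝ) (p : ℝ × S3) : ℝ :=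
  derivWithin (fun S => u (S, p.2)) (Ici 0) p.1

/-- `∂_T² u` on `[0, ∞) × S³`. -/
def timeDeriv2 (u : ℝ × S3 → ℝ) (p : ℝ × S3) : ℝ :=
  iteratedDerivWithin 2 (fun S => u (S, p.2)) (Ici 0) p.1

/-- The wave operator `□_g = ∂_T² - Δ_g` on `ℝ × S³`. -/
def waveOp (u : ℝ × S3 → ℝ) (p : ℝ × S3) : ℝ :=
  timeDeriv2 u p - sphereLaplacian (fun X => u (p.1, X)) p.2

/-- `|u'| = (|∂_T u|² + ‖grad u‖²)^{1/2}`. -/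
def normDeriv (u : ℝ × S3 → ℝ) (p : ℝ × S3) : ℝ :=
  Real.sqrt (timeDeriv u p ^ 2 + ‖sphereGrad (fun X => u (p.1, X)) p.2‖ ^ 2)

/-- The `L²(A)` norm, in `[0, ∞]`, with respect to the volume element of the standard metric
of `S³`, that is, the surface measure. -/
def L2Norm (A : Set S3) (f : S3 → ℝ) : ℝ≥0∞ :=
  eLpNorm f 2 ((volume : Measure E4).toSphere.restrict A)

end EinsteinDiamond

end

/-! The proof is the energy method on a domain with moving boundary; what makes it work is that the
boundary of the transformed obstacle never moves faster than light.

Reduction to flat space. Extend `u` to `ℝ × (ℝ⁴ \ {0})` by homogeneity of degree zero in `x`. For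
the extension `v`, the wave operator becomes `∂_T² - |x|²Δ` and `|u'|²` becomes `|∂_T v|² +
|x|²|∇v|²` (`waveOp_eq_conicalWaveOp`, `normDeriv_sq_eq_energyDensity`). Since `x · ∇v = 0`, a
radial bump supported in an annulus makes all integrands compactly supported without creating error
terms, and integrating a homogeneous function against it is a constant times integrating over `S³`.

Geometry. The Penrose map multiplies spatial coordinates by `Ω = cos R + cos T`. Hence on `S³` the
obstacle is `γ ≤ cos T`, where `γ(X)` is the gauge of `K` at the last three coordinates, minus `X₀`;
the only exception is the south pole at time 0 (`mem_transformedObstacle_iff`, `mem_exterior_iff`).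
The slices of `Y` grow with time. As the gauge does not involve `X₀`, Cauchy–Schwarz gives `|∇γ|² ≥
1 - γ²` on `S³` (`one_sub_sq_le_gradient`), which is `sin² T` on the boundary `T = arccos γ`. There
`u = 0` forces `du` to be a multiple `a` of `d(γ - cos T)`, so the flux of energy is `a² sin T (sin²
T - |∇γ|²) ≤ 0` (`levelFlux_boundary_nonpos`).

Analysis. No divergence theorem is applied on the moving domain. The energy is weighted by a cutoff
`κ` that vanishes for `γ - cos T ≤ ε` and equals the bump for `γ - cos T ≥ 2ε`. In the layer
between, continuity of `du` up to the boundary and compactness bound the flux by `d ∂_T κ`, for any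
`d > 0` and then all small `ε`. After integration in time this costs at most `d` times the mass of
`κ`, uniformly in `ε`; a regularised square root turns the differential inequality into the `L²`
bound (`sqrt_energy_le`). Fatou's lemma removes the cutoff and then the error is sent to 0
(`L2Norm_le_of_pos`).

This is done from an initial time `T₁ > 0`, because at time 0 the level `γ = cos T = 1` contains the
south pole, where `γ` need not be differentiable. Letting `T₁ → 0` by dominated convergence uses
that `{γ = 1}` is a null set (`tendsto_lintegral_normDeriv_sq`). -/

open Filter Topology

set_option linter.unusedSectionVars false

noncomputable section

namespace EinsteinDiamond

/-! ### Integrals over slices of functions with uniformly bounded spatial support. -/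

section ParametricIntegral

variable {E : Type*} [NormedAddCommGroup E] [NormedSpace ℝ E] [FiniteDimensional ℝ E]
  [MeasurableSpace E] [BorelSpace E] {μ : Measure E} [μ.IsAddHaarMeasure]

theorem continuous_slice {q : ℝ × E → ℝ} {J : Set ℝ}
    (hq : ∀ z : ℝ × E, z.1 ∈ J → ContinuousAt q z) {T : ℝ} (hT : T ∈ J) :
    Continuous fun x => q (T, x) :=
  continuous_iff_continuousAt.2 fun x =>
    ContinuousAt.comp (f := fun x : E => (T, x)) (hq (T, x) hT) (by fun_prop)

theorem hasCompactSupport_slice {q : ℝ × E → ℝ} {J : Set ℝ} {R : ℝ}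
    (hR : ∀ z : ℝ × E, z.1 ∈ J → R ≤ ‖z.2‖ → q z = 0) {T : ℝ} (hT : T ∈ J) :
    HasCompactSupport fun x => q (T, x) :=
  HasCompactSupport.intro (isCompact_closedBall 0 R) fun x hx =>
    hR (T, x) hT (by simpa using (not_le.1 (fun h => hx (by simpa using h))).le)

theorem integrable_slice {q : ℝ × E → ℝ} {J : Set ℝ} {R : ℝ}
    (hq : ∀ z : ℝ × E, z.1 ∈ J → ContinuousAt q z)
    (hR : ∀ z : ℝ × E, z.1 ∈ J → R ≤ ‖z.2‖ → q z = 0) {T : ℝ} (hT : T ∈ J) :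
    Integrable (fun x => q (T, x)) μ :=
  (continuous_slice hq hT).integrable_of_hasCompactSupport (hasCompactSupport_slice hR hT)

theorem continuousOn_integral_slice {q : ℝ × E → ℝ} {J : Set ℝ} {R : ℝ}
    (hq : ∀ z : ℝ × E, z.1 ∈ J → ContinuousAt q z)
    (hR : ∀ z : ℝ × E, z.1 ∈ J → R ≤ ‖z.2‖ → q z = 0) :
    ContinuousOn (fun T => ∫ x, q (T, x) ∂μ) J := by
  refine continuousOn_integral_of_compact_support (f := fun T x => q (T, x))
    (isCompact_closedBall (0 : E) R) ?_ ?_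
  · intro z hz
    exact (hq z hz.1).continuousWithinAt
  · intro T x hT hx
    exact hR (T, x) hT (by simpa using (not_le.1 (fun h => hx (by simpa using h))).le)

/-- The radius is enlarged by 1 so that the point has a whole neighbourhood on which `Q` vanishes.
-/
theorem fderiv_eq_zero_of_radius_le {Q : ℝ × E → ℝ} {J : Set ℝ} (hJ : IsOpen J) {R : ℝ}
    (hR : ∀ z : ℝ × E, z.1 ∈ J → R ≤ ‖z.2‖ → Q z = 0) (z : ℝ × E) (hz : z.1 ∈ J)
    (hzR : R + 1 ≤ ‖z.2‖) : fderiv ℝ Q z = 0 := by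
  have : Q =ᶠ[𝓝 z] fun _ => 0 := by
    have h1 : ∀ᶠ y : ℝ × E in 𝓝 z, y.1 ∈ J :=
      continuous_fst.continuousAt.eventually (hJ.mem_nhds hz)
    have h2 : ∀ᶠ y : ℝ × E in 𝓝 z, R < ‖y.2‖ :=
      (continuous_snd.norm.continuousAt (x := z)).eventually_const_lt (by linarith)
    filter_upwards [h1, h2] with y hy1 hy2 using hR y hy1 hy2.le
  rw [this.fderiv_eq]; simp

theorem continuousAt_fderiv_apply {Q : ℝ × E → ℝ} {z : ℝ × E} (h : ContDiffAt ℝ 1 Q z)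
    (v : ℝ × E) : ContinuousAt (fun y => fderiv ℝ Q y v) z :=
  ((h.fderiv_right (m := 0) (by norm_num)).continuousAt).clm_apply continuousAt_const

theorem hasDerivAt_integral_slice {Q : ℝ × E → ℝ} {J : Set ℝ} (hJ : IsOpen J) {R : ℝ}
    (hQ : ∀ z : ℝ × E, z.1 ∈ J → ContDiffAt ℝ 1 Q z)
    (hR : ∀ z : ℝ × E, z.1 ∈ J → R ≤ ‖z.2‖ → Q z = 0) {T : ℝ} (hT : T ∈ J) :
    HasDerivAt (fun S => ∫ x, Q (S, x) ∂μ) (∫ x, fderiv ℝ Q (T, x) (1, 0) ∂μ) T := by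
  obtain ⟨r, hr, hrJ⟩ := Metric.nhds_basis_closedBall.mem_iff.1 (hJ.mem_nhds hT)
  have hcont : ∀ z : ℝ × E, z.1 ∈ J → ContinuousAt (fun y => fderiv ℝ Q y (1, 0)) z :=
    fun z hz => continuousAt_fderiv_apply (hQ z hz) _
  obtain ⟨C, hC⟩ := ((isCompact_closedBall T r).prod
    (isCompact_closedBall (0 : E) (R + 1))).exists_bound_of_continuousOn
    (f := fun y => fderiv ℝ Q y (1, 0))
    (fun z hz => (hcont z (hrJ hz.1)).continuousWithinAt)
  refine (hasDerivAt_integral_of_dominated_loc_of_deriv_le (s := Metric.ball T r)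
    (F := fun S x => Q (S, x)) (F' := fun S x => fderiv ℝ Q (S, x) (1, 0))
    (bound := (Metric.closedBall (0 : E) (R + 1)).indicator fun _ => C)
    (Metric.ball_mem_nhds T hr) ?_ ?_ ?_ ?_ ?_ ?_).2
  · filter_upwards [hJ.mem_nhds hT] with S hS
    exact (continuous_slice (fun z hz => (hQ z hz).continuousAt) hS).aestronglyMeasurable
  · exact integrable_slice (fun z hz => (hQ z hz).continuousAt) hR hT
  · exact (continuous_slice hcont hT).aestronglyMeasurable
  · refine ae_of_all _ fun x S hS => ?_
    have hSJ : S ∈ Metric.closedBall T r := Metric.ball_subset_closedBall hS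
    by_cases hx : x ∈ Metric.closedBall (0 : E) (R + 1)
    · rw [indicator_of_mem hx]; exact hC (S, x) ⟨hSJ, hx⟩
    · rw [indicator_of_notMem hx, fderiv_eq_zero_of_radius_le hJ hR (S, x) (hrJ hSJ)
        (by simpa using (not_le.1 (fun h => hx (by simpa using h))).le)]
      simp
  · exact (integrable_indicator_iff measurableSet_closedBall).2
      (integrableOn_const (isCompact_closedBall _ _).measure_lt_top.ne)
  · refine ae_of_all _ fun x S hS => ?_
    have h1 := ((hQ (S, x) (hrJ (Metric.ball_subset_closedBall hS))).differentiableAt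
      (by norm_num)).hasFDerivAt
    exact h1.comp_hasDerivAt (f := fun S : ℝ => (S, x)) S
      ((hasDerivAt_id S).prodMk (hasDerivAt_const S x))

/-- Integration by parts against the constant function 1. -/
theorem integral_fderiv_slice_eq_zero {Q : ℝ × E → ℝ} {J : Set ℝ} (hJ : IsOpen J) {R : ℝ}
    (hQ : ∀ z : ℝ × E, z.1 ∈ J → ContDiffAt ℝ 1 Q z)
    (hR : ∀ z : ℝ × E, z.1 ∈ J → R ≤ ‖z.2‖ → Q z = 0) {T : ℝ} (hT : T ∈ J) (e : E) :
    ∫ x, fderiv ℝ Q (T, x) (0, e) ∂μ = 0 := by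
  have hd : ∀ x, HasFDerivAt (fun x => Q (T, x))
      ((fderiv ℝ Q (T, x)).comp (ContinuousLinearMap.inr ℝ ℝ E)) x := fun x =>
    (((hQ (T, x) hT).differentiableAt (by norm_num)).hasFDerivAt).comp x
      (hasFDerivAt_prodMk_right T x)
  have h1 : ∀ x, fderiv ℝ Q (T, x) (0, e) = fderiv ℝ (fun x => Q (T, x)) x e := fun x => by
    rw [(hd x).fderiv]; simp
  have hi : Integrable (fun x => fderiv ℝ Q (T, x) (0, e)) μ :=
    integrable_slice (q := fun z => fderiv ℝ Q z (0, e)) (R := R + 1)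
      (fun z hz => continuousAt_fderiv_apply (hQ z hz) _)
      (fun z hz hzR => by rw [fderiv_eq_zero_of_radius_le hJ hR z hz hzR]; simp) hT
  have := integral_mul_fderiv_eq_neg_fderiv_mul_of_integrable (μ := μ) (f := fun _ : E => (1 : ℝ))
    (g := fun x => Q (T, x)) (v := e) (by simp) (by simpa [h1] using hi)
    (by simpa using integrable_slice (fun z hz => (hQ z hz).continuousAt) hR hT)
    (fun x _ => differentiableAt_const _) (fun x _ => (hd x).differentiableAt)
  simpa [h1] using this

end ParametricIntegral

/-! ### The pointwise energy identity for the conical wave operator. -/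

section Energy

variable {E : Type*} [NormedAddCommGroup E] [InnerProductSpace ℝ E]
  {ι : Type*} [Fintype ι] (b : OrthonormalBasis ι ℝ E)

/-- The time derivative of a function on `ℝ × E`. -/
def partialT (v : ℝ × E → ℝ) (z : ℝ × E) : ℝ := fderiv ℝ v z (1, 0)

/-- The derivative in the spatial direction `b i` of a function on `ℝ × E`. -/
def partialX (v : ℝ × E → ℝ) (i : ι) (z : ℝ × E) : ℝ := fderiv ℝ v z (0, b i)

/-- The energy density `|∂_T v|² + |x|² |∇ v|²` of the conical metric. -/
def energyDensity (v : ℝ × E → ℝ) (z : ℝ × E) : ℝ :=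
  partialT v z ^ 2 + ‖z.2‖ ^ 2 * ∑ i, partialX b v i z ^ 2

/-- The operator `∂_T² - |x|² Δ`. -/
def conicalWaveOp (v : ℝ × E → ℝ) (z : ℝ × E) : ℝ :=
  partialT (partialT v) z - ‖z.2‖ ^ 2 * ∑ i, partialX b (partialX b v i) i z

/-- The energy flux of `v` through the level sets of `κ`. -/
def flux (κ v : ℝ × E → ℝ) (z : ℝ × E) : ℝ :=
  partialT κ z * energyDensity b v z
    - 2 * ‖z.2‖ ^ 2 * partialT v z * ∑ i, partialX b v i z * partialX b κ i z

variable {b}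

theorem contDiffAt_partialT {v : ℝ × E → ℝ} {z : ℝ × E} (hv : ContDiffAt ℝ 2 v z) :
    ContDiffAt ℝ 1 (partialT v) z :=
  (hv.fderiv_right (m := 1) (by norm_num)).clm_apply contDiffAt_const

theorem contDiffAt_partialX {v : ℝ × E → ℝ} {z : ℝ × E} (hv : ContDiffAt ℝ 2 v z) (i : ι) :
    ContDiffAt ℝ 1 (partialX b v i) z :=
  (hv.fderiv_right (m := 1) (by norm_num)).clm_apply contDiffAt_const

theorem contDiffAt_energyDensity {v : ℝ × E → ℝ} {z : ℝ × E} (hv : ContDiffAt ℝ 2 v z) :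
    ContDiffAt ℝ 1 (energyDensity b v) z :=
  ((contDiffAt_partialT hv).pow 2).add ((contDiffAt_snd.norm_sq ℝ).mul
    (ContDiffAt.sum fun i _ => (contDiffAt_partialX hv i).pow 2))

theorem partialT_partialX_eq {v : ℝ × E → ℝ} {z : ℝ × E} (hv : ContDiffAt ℝ 2 v z) (i : ι) :
    partialT (partialX b v i) z = partialX b (partialT v) i z := by
  have hs := hv.isSymmSndFDerivAt (by simp)
  have hd : DifferentiableAt ℝ (fderiv ℝ v) z :=
    (hv.fderiv_right (m := 1) (by norm_num)).differentiableAt (by norm_num)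
  have h : ∀ y y' : ℝ × E, fderiv ℝ (fun q => fderiv ℝ v q y) z y' = fderiv ℝ (fderiv ℝ v) z y' y := by
    intro y y'
    have := (hd.hasFDerivAt.clm_apply (hasFDerivAt_const y z)).fderiv
    rw [this]; simp
  change fderiv ℝ (fun q => fderiv ℝ v q (0, b i)) z (1, 0) =
    fderiv ℝ (fun q => fderiv ℝ v q (1, 0)) z (0, b i)
  rw [h, h]
  exact hs.eq _ _

theorem partialX_sum_inner (v : ℝ × E → ℝ) (z : ℝ × E) (y : E) :
    ∑ i, partialX b v i z * inner ℝ (b i) y = fderiv ℝ v z (0, y) := by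
  conv_rhs => rw [← b.sum_repr' y]
  have : ((0 : ℝ), ∑ i, inner ℝ (b i) y • b i) = ∑ i, inner ℝ (b i) y • ((0 : ℝ), b i) := by
    ext <;> simp [Prod.fst_sum, Prod.snd_sum]
  rw [this, map_sum]
  refine Finset.sum_congr rfl fun i _ => ?_
  rw [map_smul, smul_eq_mul, mul_comm]
  rfl

/-- The multiplier identity obtained from `2 κ ∂_T v`. The weight `|x|²` is not constant: its
derivative contributes `4 κ ∂_T v (x · ∇v)`, which `hrad` removes. The mixed second derivatives
cancel by symmetry, and derivatives falling on `κ` are collected in `flux`. -/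
theorem energy_flux_identity {v κ : ℝ × E → ℝ} {z : ℝ × E} (hv : ContDiffAt ℝ 2 v z)
    (hκ : ContDiffAt ℝ 1 κ z) (hrad : fderiv ℝ v z (0, z.2) = 0) :
    partialT (fun y => κ y * energyDensity b v y) z
      - ∑ i, partialX b (fun y => 2 * (‖y.2‖ ^ 2 * (κ y * (partialT v y * partialX b v i y)))) i z =
    flux b κ v z + 2 * (κ z * (partialT v z * conicalWaveOp b v z)) := by
  have h1 : (1 : WithTop ℕ∞) ≠ 0 := by norm_num
  have hκd := (hκ.differentiableAt h1).hasFDerivAt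
  have ha := ((contDiffAt_partialT hv).differentiableAt h1).hasFDerivAt
  have hb := fun i => ((contDiffAt_partialX (b := b) hv i).differentiableAt h1).hasFDerivAt
  have hn : HasFDerivAt (fun y : ℝ × E => ‖y.2‖ ^ 2)
      ((2 • innerSL ℝ z.2).comp (ContinuousLinearMap.snd ℝ ℝ E)) z :=
    (hasStrictFDerivAt_norm_sq z.2).hasFDerivAt.comp z hasFDerivAt_snd
  have he : HasFDerivAt (energyDensity b v) _ z :=
    (ha.pow 2).add (hn.mul (HasFDerivAt.fun_sum (u := Finset.univ) fun i _ => (hb i).pow 2))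
  have hL : partialT (fun y => κ y * energyDensity b v y) z =
      partialT κ z * energyDensity b v z + κ z * (2 * partialT v z * partialT (partialT v) z
        + ‖z.2‖ ^ 2 * ∑ i, 2 * partialX b v i z * partialX b (partialT v) i z) := by
    simp only [← partialT_partialX_eq hv]
    rw [partialT, (hκd.fun_mul he).fderiv]
    simp only [partialT, Finset.mul_sum, mul_add]
    simp [Finset.mul_sum]
    ring
  have hR : ∀ i, partialX b
      (fun y => 2 * (‖y.2‖ ^ 2 * (κ y * (partialT v y * partialX b v i y)))) i z =
      2 * (2 * inner ℝ z.2 (b i) * (κ z * (partialT v z * partialX b v i z)) + ‖z.2‖ ^ 2 *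
        (partialX b κ i z * (partialT v z * partialX b v i z)
          + κ z * (partialX b (partialT v) i z * partialX b v i z
            + partialT v z * partialX b (partialX b v i) i z))) := by
    intro i
    rw [partialX, ((hn.fun_mul (hκd.fun_mul (ha.fun_mul (hb i)))).const_mul 2).fderiv]
    simp [partialX]
    ring
  have h0 := partialX_sum_inner (b := b) v z z.2
  rw [hrad] at h0
  rw [hL, Finset.sum_congr rfl fun i _ => hR i, flux, conicalWaveOp]
  have e1 : ∑ i, 2 * (2 * inner ℝ z.2 (b i) * (κ z * (partialT v z * partialX b v i z)) + ‖z.2‖ ^ 2 *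
        (partialX b κ i z * (partialT v z * partialX b v i z)
          + κ z * (partialX b (partialT v) i z * partialX b v i z
            + partialT v z * partialX b (partialX b v i) i z))) =
      4 * κ z * partialT v z * ∑ i, partialX b v i z * inner ℝ (b i) z.2
      + 2 * ‖z.2‖ ^ 2 * partialT v z * ∑ i, partialX b v i z * partialX b κ i z
      + κ z * ‖z.2‖ ^ 2 * ∑ i, 2 * partialX b v i z * partialX b (partialT v) i z
      + 2 * ‖z.2‖ ^ 2 * κ z * partialT v z * ∑ i, partialX b (partialX b v i) i z := by
    simp only [Finset.mul_sum, ← Finset.sum_add_distrib]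
    refine Finset.sum_congr rfl fun i _ => ?_
    rw [real_inner_comm]
    ring
  rw [e1, h0]
  ring

end Energy

/-! ### The weighted energy inequality for an abstract cutoff. -/

section EnergyInequality

variable {E : Type*} [NormedAddCommGroup E] [InnerProductSpace ℝ E] [FiniteDimensional ℝ E]
  [MeasurableSpace E] [BorelSpace E] {μ : Measure E} [μ.IsAddHaarMeasure]
  {ι : Type*} [Fintype ι] {b : OrthonormalBasis ι ℝ E}

theorem continuousAt_conicalWaveOp {v : ℝ × E → ℝ} {z : ℝ × E} (hv : ContDiffAt ℝ 2 v z) :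
    ContinuousAt (conicalWaveOp b v) z := by
  refine (continuousAt_fderiv_apply (contDiffAt_partialT hv) _).sub
    ((continuous_snd.norm.pow 2).continuousAt.mul (tendsto_finsetSum _ fun i _ => ?_))
  exact continuousAt_fderiv_apply (contDiffAt_partialX hv i) _

/-- `κ` is a `C¹` cutoff function over the time interval `J`, of spatial radius `R`, and supported
in `W`. -/
structure IsCutoff (κ : ℝ × E → ℝ) (J : Set ℝ) (W : Set (ℝ × E)) (R : ℝ) : Prop where
  isOpen : IsOpen J
  contDiffAt : ∀ z : ℝ × E, z.1 ∈ J → ContDiffAt ℝ 1 κ z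
  eventually_eq_zero : ∀ z : ℝ × E, z.1 ∈ J → z ∉ W → κ =ᶠ[𝓝 z] fun _ => 0
  eq_zero : ∀ z : ℝ × E, z.1 ∈ J → R ≤ ‖z.2‖ → κ z = 0
  nonneg : ∀ z : ℝ × E, z.1 ∈ J → 0 ≤ κ z
  partialT_nonneg : ∀ z : ℝ × E, z.1 ∈ J → 0 ≤ partialT κ z

variable {κ v q : ℝ × E → ℝ} {J : Set ℝ} {W : Set (ℝ × E)} {R : ℝ}

theorem IsCutoff.contDiffAt_mul (hκ : IsCutoff κ J W R) (hq : ∀ z ∈ W, ContDiffAt ℝ 1 q z)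
    (z : ℝ × E) (hz : z.1 ∈ J) : ContDiffAt ℝ 1 (fun y => κ y * q y) z := by
  by_cases hzW : z ∈ W
  · exact (hκ.contDiffAt z hz).mul (hq z hzW)
  · refine (contDiffAt_const (c := (0 : ℝ))).congr_of_eventuallyEq ?_
    filter_upwards [hκ.eventually_eq_zero z hz hzW] with y hy
    simp [hy]

theorem IsCutoff.continuousAt_mul (hκ : IsCutoff κ J W R) (hq : ∀ z ∈ W, ContinuousAt q z)
    (z : ℝ × E) (hz : z.1 ∈ J) : ContinuousAt (fun y => κ y * q y) z := by
  by_cases hzW : z ∈ W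
  · exact (hκ.contDiffAt z hz).continuousAt.mul (hq z hzW)
  · refine (continuousAt_const (y := (0 : ℝ))).congr ?_
    filter_upwards [hκ.eventually_eq_zero z hz hzW] with y hy
    simp [hy]

theorem IsCutoff.mul_eq_zero (hκ : IsCutoff κ J W R) (z : ℝ × E) (hz : z.1 ∈ J)
    (hzR : R ≤ ‖z.2‖) : κ z * q z = 0 := by rw [hκ.eq_zero z hz hzR, zero_mul]

theorem IsCutoff.integrable_mul (hκ : IsCutoff κ J W R) (hq : ∀ z ∈ W, ContinuousAt q z)
    {T : ℝ} (hT : T ∈ J) : Integrable (fun x => κ (T, x) * q (T, x)) μ :=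
  integrable_slice (q := fun z => κ z * q z) (hκ.continuousAt_mul hq) (hκ.mul_eq_zero) hT

theorem IsCutoff.integrable_partialT (hκ : IsCutoff κ J W R) {T : ℝ} (hT : T ∈ J) :
    Integrable (fun x => partialT κ (T, x)) μ := by
  refine integrable_slice (q := partialT κ) (R := R + 1)
    (fun z hz => continuousAt_fderiv_apply (hκ.contDiffAt z hz) _) (fun z hz hzR => ?_) hT
  rw [partialT, fderiv_eq_zero_of_radius_le hκ.isOpen hκ.eq_zero z hz hzR]; simp

theorem IsCutoff.hasDerivAt_mass (hκ : IsCutoff κ J W R) {T : ℝ} (hT : T ∈ J) :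
    HasDerivAt (fun S => ∫ x, κ (S, x) ∂μ) (∫ x, partialT κ (T, x) ∂μ) T :=
  hasDerivAt_integral_slice hκ.isOpen hκ.contDiffAt hκ.eq_zero hT

theorem IsCutoff.partial_eq_zero (hκ : IsCutoff κ J W R) {z : ℝ × E} (hz : z.1 ∈ J)
    (hzW : z ∉ W) : fderiv ℝ (fun y => κ y * q y) z = 0 := by
  have : (fun y => κ y * q y) =ᶠ[𝓝 z] fun _ => 0 := by
    filter_upwards [hκ.eventually_eq_zero z hz hzW] with y hy
    simp [hy]
  rw [this.fderiv_eq]; simp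

/-- Weighted Cauchy–Schwarz: the quadratic polynomial `l ↦ ∫ k (l f + g)²` is nonnegative, so its
discriminant is at most 0. -/
theorem integral_mul_sq_le {f g k : E → ℝ} (hk : ∀ x, 0 ≤ k x)
    (hff : Integrable (fun x => k x * f x ^ 2) μ) (hfg : Integrable (fun x => k x * (f x * g x)) μ)
    (hgg : Integrable (fun x => k x * g x ^ 2) μ) :
    (∫ x, k x * (f x * g x) ∂μ) ^ 2 ≤ (∫ x, k x * f x ^ 2 ∂μ) * ∫ x, k x * g x ^ 2 ∂μ := by
  have key : ∀ l : ℝ, 0 ≤ (∫ x, k x * f x ^ 2 ∂μ) * (l * l)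
      + (2 * ∫ x, k x * (f x * g x) ∂μ) * l + ∫ x, k x * g x ^ 2 ∂μ := by
    intro l
    have h0 : 0 ≤ ∫ x, k x * (l * f x + g x) ^ 2 ∂μ :=
      integral_nonneg fun x => mul_nonneg (hk x) (sq_nonneg _)
    have h1 : (fun x => k x * (l * f x + g x) ^ 2) = fun x => l * l * (k x * f x ^ 2)
        + 2 * l * (k x * (f x * g x)) + k x * g x ^ 2 := by
      funext x; ring
    rw [h1, integral_add (f := fun x => l * l * (k x * f x ^ 2)
        + 2 * l * (k x * (f x * g x))) ((hff.const_mul _).add (hfg.const_mul _)) hgg,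
      integral_add (hff.const_mul _) (hfg.const_mul _), integral_const_mul,
      integral_const_mul] at h0
    linarith
  have := discrim_le_zero key
  rw [discrim] at this
  nlinarith

/-- The energy of `v`, weighted by the cutoff function `κ`. -/
def energy (μ : Measure E) (b : OrthonormalBasis ι ℝ E) (κ v : ℝ × E → ℝ) (T : ℝ) : ℝ :=
  ∫ x, κ (T, x) * energyDensity b v (T, x) ∂μ

/-- The `L²` norm of the source term, weighted by the cutoff function `κ`. -/
def sourceNorm (μ : Measure E) (b : OrthonormalBasis ι ℝ E) (κ v : ℝ × E → ℝ) (T : ℝ) : ℝ :=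
  √(∫ x, κ (T, x) * conicalWaveOp b v (T, x) ^ 2 ∂μ)

theorem energyDensity_nonneg (z : ℝ × E) : 0 ≤ energyDensity b v z :=
  add_nonneg (sq_nonneg _) (mul_nonneg (sq_nonneg _) (Finset.sum_nonneg fun _ _ => sq_nonneg _))

theorem energy_nonneg (hκ : IsCutoff κ J W R) {T : ℝ} (hT : T ∈ J) : 0 ≤ energy μ b κ v T :=
  integral_nonneg fun x => mul_nonneg (hκ.nonneg (T, x) hT) (energyDensity_nonneg _)

theorem continuousOn_sourceNorm (hκ : IsCutoff κ J W R) (hv : ∀ z ∈ W, ContDiffAt ℝ 2 v z) :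
    ContinuousOn (sourceNorm μ b κ v) J :=
  (continuousOn_integral_slice (q := fun z => κ z * conicalWaveOp b v z ^ 2)
    (hκ.continuousAt_mul fun z hz => (continuousAt_conicalWaveOp (hv z hz)).pow 2)
    hκ.mul_eq_zero).sqrt

theorem hasDerivAt_energy (hκ : IsCutoff κ J W R) (hv : ∀ z ∈ W, ContDiffAt ℝ 2 v z) {T : ℝ}
    (hT : T ∈ J) : HasDerivAt (energy μ b κ v)
      (∫ x, partialT (fun y => κ y * energyDensity b v y) (T, x) ∂μ) T :=
  hasDerivAt_integral_slice hκ.isOpen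
    (hκ.contDiffAt_mul fun z hz => contDiffAt_energyDensity (hv z hz)) hκ.mul_eq_zero hT

/-- Integrate `energy_flux_identity` in space: the divergence disappears, the flux is controlled by
`hflux`, and the source term by Cauchy–Schwarz, with `∂_T v` bounded by the full energy density.
Outside `W` nothing is known about `v`, but `κ` vanishes near such points and so do all the terms.
-/
theorem integral_partialT_energy_le (hκ : IsCutoff κ J W R) (hv : ∀ z ∈ W, ContDiffAt ℝ 2 v z)
    (hrad : ∀ z ∈ W, fderiv ℝ v z (0, z.2) = 0) {d : ℝ}
    (hflux : ∀ z ∈ W, z.1 ∈ J → flux b κ v z ≤ d * partialT κ z) {T : ℝ} (hT : T ∈ J) :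
    ∫ x, partialT (fun y => κ y * energyDensity b v y) (T, x) ∂μ ≤
      d * (∫ x, partialT κ (T, x) ∂μ) + 2 * (√(energy μ b κ v T) * sourceNorm μ b κ v T) := by
  set Q : ι → ℝ × E → ℝ :=
    fun i y => 2 * (‖y.2‖ ^ 2 * (κ y * (partialT v y * partialX b v i y))) with hQdef
  have hQ : ∀ i z, z.1 ∈ J → ContDiffAt ℝ 1 (Q i) z := fun i z hz =>
    contDiffAt_const.mul ((contDiffAt_snd.norm_sq ℝ).mul
      (hκ.contDiffAt_mul (fun z hz => (contDiffAt_partialT (hv z hz)).mul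
        (contDiffAt_partialX (hv z hz) i)) z hz))
  have hQ0 : ∀ i z, z.1 ∈ J → R ≤ ‖z.2‖ → Q i z = 0 := fun i z hz hzR => by
    simp [hQdef, hκ.eq_zero z hz hzR]
  have hQW : ∀ i z, z.1 ∈ J → z ∉ W → partialX b (Q i) i z = 0 := fun i z hz hzW => by
    have : Q i =ᶠ[𝓝 z] fun _ => 0 := by
      filter_upwards [hκ.eventually_eq_zero z hz hzW] with y hy
      simp [hQdef, hy]
    rw [partialX, this.fderiv_eq]; simp
  have hQi : ∀ i, Integrable (fun x => partialX b (Q i) i (T, x)) μ := fun i =>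
    integrable_slice (q := partialX b (Q i) i) (R := R + 1)
      (fun z hz => continuousAt_fderiv_apply (hQ i z hz) _)
      (fun z hz hzR => by
        rw [partialX, fderiv_eq_zero_of_radius_le hκ.isOpen (hQ0 i) z hz hzR]; simp) hT
  have hsum : ∫ x, ∑ i, partialX b (Q i) i (T, x) ∂μ = 0 := by
    rw [integral_finsetSum _ fun i _ => hQi i]
    exact Finset.sum_eq_zero fun i _ =>
      integral_fderiv_slice_eq_zero hκ.isOpen (hQ i) (hQ0 i) hT (b i)
  have hEi : Integrable (fun x => partialT (fun y => κ y * energyDensity b v y) (T, x)) μ :=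
    integrable_slice (q := partialT (fun y => κ y * energyDensity b v y)) (R := R + 1)
      (fun z hz => continuousAt_fderiv_apply (hκ.contDiffAt_mul
        (fun z hz => contDiffAt_energyDensity (hv z hz)) z hz) _)
      (fun z hz hzR => by
        rw [partialT, fderiv_eq_zero_of_radius_le hκ.isOpen hκ.mul_eq_zero z hz hzR]; simp) hT
  have ha : ∀ z ∈ W, ContinuousAt (partialT v) z := fun z hz =>
    (contDiffAt_partialT (hv z hz)).continuousAt
  have hF : ∀ z ∈ W, ContinuousAt (conicalWaveOp b v) z := fun z hz =>
    continuousAt_conicalWaveOp (hv z hz)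
  have haF : Integrable (fun x => κ (T, x) * (partialT v (T, x) * conicalWaveOp b v (T, x))) μ :=
    hκ.integrable_mul (q := fun z => partialT v z * conicalWaveOp b v z)
      (fun z hz => (ha z hz).mul (hF z hz)) hT
  have haa : Integrable (fun x => κ (T, x) * partialT v (T, x) ^ 2) μ :=
    hκ.integrable_mul (q := fun z => partialT v z ^ 2) (fun z hz => (ha z hz).pow 2) hT
  have hFF : Integrable (fun x => κ (T, x) * conicalWaveOp b v (T, x) ^ 2) μ :=
    hκ.integrable_mul (q := fun z => conicalWaveOp b v z ^ 2) (fun z hz => (hF z hz).pow 2) hT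
  have hpt : ∀ x, partialT (fun y => κ y * energyDensity b v y) (T, x)
      - ∑ i, partialX b (Q i) i (T, x) ≤
      d * partialT κ (T, x) + 2 * (κ (T, x) * (partialT v (T, x) * conicalWaveOp b v (T, x))) := by
    intro x
    by_cases hx : (T, x) ∈ W
    · rw [energy_flux_identity (hv _ hx) (hκ.contDiffAt _ hT) (hrad _ hx)]
      linarith [hflux _ hx hT]
    · have h1 : κ (T, x) = 0 := (hκ.eventually_eq_zero (T, x) hT hx).eq_of_nhds
      have h2 : partialT κ (T, x) = 0 := by
        rw [partialT, (hκ.eventually_eq_zero (T, x) hT hx).fderiv_eq]; simp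
      have h3 : partialT (fun y => κ y * energyDensity b v y) (T, x) = 0 := by
        rw [partialT, hκ.partial_eq_zero hT hx]; simp
      rw [h1, h2, h3, Finset.sum_eq_zero fun i _ => hQW i (T, x) hT hx]
      simp
  have h4 : ∫ x, partialT (fun y => κ y * energyDensity b v y) (T, x) ∂μ ≤
      d * (∫ x, partialT κ (T, x) ∂μ)
        + 2 * ∫ x, κ (T, x) * (partialT v (T, x) * conicalWaveOp b v (T, x)) ∂μ := by
    have h5 := integral_mono (hEi.sub (integrable_finsetSum _ fun i _ => hQi i))
      ((hκ.integrable_partialT hT).const_mul d |>.add (haF.const_mul 2)) hpt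
    simp only [Pi.sub_apply, Pi.add_apply] at h5
    rwa [integral_sub hEi (integrable_finsetSum _ fun i _ => hQi i), hsum, sub_zero,
      integral_add ((hκ.integrable_partialT hT).const_mul d) (haF.const_mul 2),
      integral_const_mul, integral_const_mul] at h5
  have h6 : ∫ x, κ (T, x) * partialT v (T, x) ^ 2 ∂μ ≤ energy μ b κ v T := by
    refine integral_mono haa (hκ.integrable_mul
      (fun z hz => (contDiffAt_energyDensity (hv z hz)).continuousAt) hT) fun x => ?_
    refine mul_le_mul_of_nonneg_left ?_ (hκ.nonneg _ hT)
    exact le_add_of_nonneg_right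
      (mul_nonneg (sq_nonneg _) (Finset.sum_nonneg fun _ _ => sq_nonneg _))
  have h7 : ∫ x, κ (T, x) * (partialT v (T, x) * conicalWaveOp b v (T, x)) ∂μ ≤
      √(energy μ b κ v T) * sourceNorm μ b κ v T := by
    rw [sourceNorm, ← Real.sqrt_mul (energy_nonneg hκ hT)]
    refine Real.le_sqrt_of_sq_le ?_
    refine (integral_mul_sq_le (fun x => hκ.nonneg (T, x) hT) haa haF hFF).trans ?_
    exact mul_le_mul_of_nonneg_right h6
      (integral_nonneg fun x => mul_nonneg (hκ.nonneg (T, x) hT) (sq_nonneg _))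
  linarith

/-- Divide the differential inequality for the energy by `2 √(E + δ)`. The shift by `δ` keeps the
square root differentiable where the energy vanishes, and bounds the factor in front of the flux
error by `1 / (2√δ)`. That error is a multiple of the derivative of the mass of `κ`, so it
integrates exactly. -/
theorem sqrt_energy_le (hκ : IsCutoff κ J W R) (hv : ∀ z ∈ W, ContDiffAt ℝ 2 v z)
    (hrad : ∀ z ∈ W, fderiv ℝ v z (0, z.2) = 0) {d : ℝ} (hd : 0 ≤ d)
    (hflux : ∀ z ∈ W, z.1 ∈ J → flux b κ v z ≤ d * partialT κ z) {T₁ T₂ δ : ℝ} (hδ : 0 < δ)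
    (hT : T₁ ≤ T₂) (hTJ : Icc T₁ T₂ ⊆ J) :
    √(energy μ b κ v T₂ + δ) ≤ √(energy μ b κ v T₁ + δ)
      + (∫ S in T₁..T₂, sourceNorm μ b κ v S)
      + d / (2 * √δ) * ((∫ x, κ (T₂, x) ∂μ) - ∫ x, κ (T₁, x) ∂μ) := by
  have hs : 0 < √δ := Real.sqrt_pos.2 hδ
  have hfc := continuousOn_sourceNorm (μ := μ) (b := b) hκ hv
  -- The claim is that this function decreases; comparing its values at the two endpoints is the
  -- conclusion.
  set Φ : ℝ → ℝ := fun S => √(energy μ b κ v S + δ) - (∫ s in T₁..S, sourceNorm μ b κ v s)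
    - d / (2 * √δ) * ∫ x, κ (S, x) ∂μ with hΦ
  have hder : ∀ S ∈ Icc T₁ T₂, HasDerivAt Φ
      ((∫ x, partialT (fun y => κ y * energyDensity b v y) (S, x) ∂μ)
          / (2 * √(energy μ b κ v S + δ)) - sourceNorm μ b κ v S
        - d / (2 * √δ) * ∫ x, partialT κ (S, x) ∂μ) S := by
    intro S hS
    have hSJ := hTJ hS
    have hpos : energy μ b κ v S + δ ≠ 0 := by linarith [energy_nonneg (μ := μ) (b := b) (v := v) hκ hSJ]
    refine ((((hasDerivAt_energy hκ hv hSJ).add_const δ).sqrt hpos).sub ?_).sub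
      ((hκ.hasDerivAt_mass hSJ).const_mul _)
    refine intervalIntegral.integral_hasDerivAt_right ?_ ?_
      (hfc.continuousAt (hκ.isOpen.mem_nhds hSJ))
    · refine (hfc.mono ?_).intervalIntegrable
      rw [uIcc_of_le hS.1]
      exact (Icc_subset_Icc_right hS.2).trans hTJ
    · exact hfc.stronglyMeasurableAtFilter hκ.isOpen S hSJ
  have hanti : AntitoneOn Φ (Icc T₁ T₂) := by
    refine antitoneOn_of_deriv_nonpos (convex_Icc _ _)
      (fun S hS => (hder S hS).continuousAt.continuousWithinAt)
      (fun S hS => (hder S (interior_subset hS)).differentiableAt.differentiableWithinAt) ?_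
    intro S hS
    have hS := interior_subset hS
    have hSJ := hTJ hS
    rw [(hder S hS).deriv]
    have h1 := integral_partialT_energy_le (μ := μ) hκ hv hrad hflux hSJ
    have hE := energy_nonneg (μ := μ) (b := b) (v := v) hκ hSJ
    have hf : 0 ≤ sourceNorm μ b κ v S := Real.sqrt_nonneg _
    have hB : 0 ≤ ∫ x, partialT κ (S, x) ∂μ :=
      integral_nonneg fun x => hκ.partialT_nonneg (S, x) hSJ
    have hsE : √δ ≤ √(energy μ b κ v S + δ) := Real.sqrt_le_sqrt (by linarith)
    have hsE' : √(energy μ b κ v S) ≤ √(energy μ b κ v S + δ) := Real.sqrt_le_sqrt (by linarith)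
    set r := √(energy μ b κ v S + δ)
    have hr : 0 < r := hs.trans_le hsE
    have h2 : (∫ x, partialT (fun y => κ y * energyDensity b v y) (S, x) ∂μ) / (2 * r) ≤
        d / (2 * √δ) * (∫ x, partialT κ (S, x) ∂μ) + sourceNorm μ b κ v S := by
      rw [div_le_iff₀ (by positivity)]
      have h3 : d * (∫ x, partialT κ (S, x) ∂μ) ≤
          d / (2 * √δ) * (∫ x, partialT κ (S, x) ∂μ) * (2 * r) := by
        have : d / (2 * √δ) * (∫ x, partialT κ (S, x) ∂μ) * (2 * r) =
            d * (∫ x, partialT κ (S, x) ∂μ) * (r / √δ) := by field_simp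
        rw [this]
        exact le_mul_of_one_le_right (mul_nonneg hd hB) ((one_le_div hs).2 hsE)
      have h4 := mul_le_mul_of_nonneg_right hsE' hf
      linarith
    linarith
  have := hanti (left_mem_Icc.2 hT) (right_mem_Icc.2 hT) hT
  simp only [hΦ, intervalIntegral.integral_same] at this
  linarith

end EnergyInequality

/-! ### Smoothness and homogeneity of the radial projections. -/

section RadialProjection

/-- In the target, the chart at `f x` is stereographic projection from the antipode `-f x`, followed
by a linear isometry; its formula in the ambient space is smooth near `f x`. The pointwise form is
needed because radial projection is singular at the origin. -/
theorem contMDiffAt_sphere {E F : Type*} [NormedAddCommGroup E] [InnerProductSpace ℝ E]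
    [NormedAddCommGroup F] [NormedSpace ℝ F] {m : ℕ∞ω} {n : ℕ} [Fact (Module.finrank ℝ E = n + 1)]
    {f : F → Metric.sphere (0 : E) 1} {x : F} (hf : ContDiffAt ℝ m (fun y => (f y : E)) x) :
    ContMDiffAt 𝓘(ℝ, F) (𝓡 n) m f x := by
  rw [contMDiffAt_iff_target]
  refine ⟨Topology.IsInducing.subtypeVal.continuousAt_iff.2 hf.continuousAt, ?_⟩
  rw [contMDiffAt_iff_contDiffAt]
  let U : _ ≃ₗᵢ[ℝ] _ :=
    (OrthonormalBasis.fromOrthogonalSpanSingleton (𝕜 := ℝ)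
        n (ne_zero_of_mem_unit_sphere (-f x))).repr
  have h1 : ContDiffAt ℝ m (stereoToFun ((-f x : Metric.sphere (0 : E) 1) : E)) (f x : E) := by
    refine (contDiffOn_stereoToFun.contDiffAt ?_)
    refine IsOpen.mem_nhds ?_ ?_
    · exact isOpen_ne_fun (by fun_prop) continuous_const
    · simp
      norm_num
  have h2 : ContDiffAt ℝ m (fun y => U (stereoToFun ((-f x : Metric.sphere (0 : E) 1) : E)
      (f y : E))) x :=
    U.contDiff.contDiffAt.comp x (ContDiffAt.comp (f := fun y => (f y : E)) x h1 hf)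
  exact h2

/-- The radial projection `x ↦ x / |x|` of `ℝ³ \ {0}` onto `S²`. -/
def radialProj3 (x : E3) : S2 :=
  if hx : x = 0 then ⟨!₂[1, 0, 0], by simp [EuclideanSpace.norm_eq, Fin.sum_univ_three]⟩
  else ⟨‖x‖⁻¹ • x, by simp [norm_smul, hx]⟩

theorem coe_radialProj3 {x : E3} (hx : x ≠ 0) : (radialProj3 x : E3) = ‖x‖⁻¹ • x := by
  simp [radialProj3, hx]

theorem coe_radialProj {x : E4} (hx : x ≠ 0) : (radialProj x : E4) = ‖x‖⁻¹ • x := by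
  simp [radialProj, hx]

theorem radialProj_coe (X : S3) : radialProj (X : E4) = X := by
  have h : ‖(X : E4)‖ = 1 := by simp
  apply Subtype.ext
  rw [coe_radialProj (norm_ne_zero_iff.1 (by rw [h]; norm_num)), h, inv_one, one_smul]

theorem radialProj_smul {c : ℝ} (hc : 0 < c) (x : E4) : radialProj (c • x) = radialProj x := by
  by_cases hx : x = 0
  · simp [hx]
  · apply Subtype.ext
    rw [coe_radialProj hx, coe_radialProj (smul_ne_zero hc.ne' hx), norm_smul, smul_smul,
      Real.norm_of_nonneg hc.le]
    congr 1
    field_simp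

theorem radialProj3_smul {c : ℝ} (hc : 0 < c) (x : E3) : radialProj3 (c • x) = radialProj3 x := by
  by_cases hx : x = 0
  · simp [hx]
  · apply Subtype.ext
    rw [coe_radialProj3 hx, coe_radialProj3 (smul_ne_zero hc.ne' hx), norm_smul, smul_smul,
      Real.norm_of_nonneg hc.le]
    congr 1
    field_simp

theorem contDiffAt_normalize {E : Type*} [NormedAddCommGroup E] [InnerProductSpace ℝ E] {x : E}
    (hx : x ≠ 0) {m : ℕ∞ω} : ContDiffAt ℝ m (fun y : E => ‖y‖⁻¹ • y) x :=
  ((contDiffAt_norm ℝ hx).inv (norm_ne_zero_iff.2 hx)).smul contDiffAt_id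

theorem contMDiffAt_radialProj {x : E4} (hx : x ≠ 0) {m : ℕ∞ω} :
    ContMDiffAt 𝓘(ℝ, E4) (𝓡 3) m radialProj x := by
  refine contMDiffAt_sphere ((contDiffAt_normalize hx).congr_of_eventuallyEq ?_)
  filter_upwards [isOpen_ne.mem_nhds hx] with y hy using coe_radialProj hy

theorem contMDiffAt_radialProj3 {x : E3} (hx : x ≠ 0) {m : ℕ∞ω} :
    ContMDiffAt 𝓘(ℝ, E3) (𝓡 2) m radialProj3 x := by
  refine contMDiffAt_sphere ((contDiffAt_normalize hx).congr_of_eventuallyEq ?_)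
  filter_upwards [isOpen_ne.mem_nhds hx] with y hy using coe_radialProj3 hy

end RadialProjection

/-! ### The gauge of the obstacle and the gradient bound for its defining function. -/

section Gauge

/-- The last three coordinates of a point of `ℝ⁴`. -/
def spatial : E4 →L[ℝ] E3 :=
  ((EuclideanSpace.equiv (Fin 3) ℝ).symm : (Fin 3 → ℝ) →L[ℝ] E3).comp
    (ContinuousLinearMap.pi fun i => EuclideanSpace.proj i.succ)

@[simp]
theorem spatial_apply (x : E4) (i : Fin 3) : spatial x i = x i.succ := rfl

/-- The north pole of `S³`. -/
def northPole : E4 := EuclideanSpace.single 0 1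

@[simp]
theorem spatial_northPole : spatial northPole = 0 := by
  ext i
  simp [northPole, Fin.succ_ne_zero]

theorem norm_sq_eq_spatial (x : E4) : ‖x‖ ^ 2 = x 0 ^ 2 + ‖spatial x‖ ^ 2 := by
  rw [EuclideanSpace.real_norm_sq_eq, EuclideanSpace.real_norm_sq_eq, Fin.sum_univ_succ]
  rfl

/-- The gauge of the star-shaped set with radial function `φ`. -/
def starGauge (φ : S2 → ℝ) (y : E3) : ℝ := ‖y‖ / φ (radialProj3 y)

/-- The function `γ` on `ℝ⁴ \ {0}`, homogeneous of degree zero, for which the transformed obstacle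
is `γ ≤ cos T`. -/
def obstacleFun (φ : S2 → ℝ) (x : E4) : ℝ := (starGauge φ (spatial x) - x 0) / ‖x‖

variable {φ : S2 → ℝ}

theorem starGauge_smul {c : ℝ} (hc : 0 < c) (y : E3) :
    starGauge φ (c • y) = c * starGauge φ y := by
  rw [starGauge, starGauge, radialProj3_smul hc, norm_smul, Real.norm_of_nonneg hc.le, mul_div_assoc]

theorem starGauge_pos (hφ : ∀ θ, 0 < φ θ) {y : E3} (hy : y ≠ 0) : 0 < starGauge φ y :=
  div_pos (norm_pos_iff.2 hy) (hφ _)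

@[simp]
theorem starGauge_zero : starGauge φ 0 = 0 := by simp [starGauge]

theorem starGauge_nonneg (hφ : ∀ θ, 0 < φ θ) (y : E3) : 0 ≤ starGauge φ y :=
  div_nonneg (norm_nonneg _) (hφ _).le

theorem obstacleFun_smul {c : ℝ} (hc : 0 < c) (x : E4) :
    obstacleFun φ (c • x) = obstacleFun φ x := by
  rw [obstacleFun, obstacleFun, map_smul, starGauge_smul hc, norm_smul, Real.norm_of_nonneg hc.le]
  simp only [PiLp.smul_apply, smul_eq_mul]
  rw [← mul_sub, mul_div_mul_left _ _ hc.ne']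

theorem contDiffAt_starGauge (hφs : ContMDiff (𝓡 2) 𝓘(ℝ, ℝ) ∞ φ) (hφ : ∀ θ, 0 < φ θ) {y : E3}
    (hy : y ≠ 0) : ContDiffAt ℝ 1 (starGauge φ) y := by
  have h1 : ContDiffAt ℝ 1 (φ ∘ radialProj3) y := by
    rw [← contMDiffAt_iff_contDiffAt]
    exact ((hφs.of_le (by exact_mod_cast le_top)).contMDiffAt).comp y (contMDiffAt_radialProj3 hy)
  exact (contDiffAt_norm ℝ hy).div h1 (hφ _).ne'

theorem continuous_starGauge (hφs : ContMDiff (𝓡 2) 𝓘(ℝ, ℝ) ∞ φ) (hφ : ∀ θ, 0 < φ θ) :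
    Continuous (starGauge φ) := by
  rw [continuous_iff_continuousAt]
  intro y
  by_cases hy : y = 0
  · subst hy
    -- The positive minimum of `φ` gives a linear bound for the gauge at the origin, where
    -- `radialProj3` is discontinuous.
    obtain ⟨θ₀, -, hθ₀⟩ := isCompact_univ.exists_isMinOn ⟨radialProj3 0, mem_univ _⟩
      hφs.continuous.continuousOn
    have h0 : Tendsto (fun y : E3 => ‖y‖ / φ θ₀) (𝓝 0) (𝓝 0) := by
      have : Continuous fun y : E3 => ‖y‖ / φ θ₀ := by fun_prop
      simpa using this.tendsto 0
    rw [ContinuousAt, starGauge_zero]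
    refine squeeze_zero (starGauge_nonneg hφ) (fun y => ?_) h0
    exact div_le_div_of_nonneg_left (norm_nonneg _) (hφ _) (hθ₀ (mem_univ _))
  · exact (contDiffAt_starGauge hφs hφ hy).continuousAt

theorem continuousAt_obstacleFun (hφs : ContMDiff (𝓡 2) 𝓘(ℝ, ℝ) ∞ φ) (hφ : ∀ θ, 0 < φ θ) {x : E4}
    (hx : x ≠ 0) : ContinuousAt (obstacleFun φ) x := by
  have h := (continuous_starGauge hφs hφ)
  refine ContinuousAt.div ?_ (by fun_prop) (norm_ne_zero_iff.2 hx)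
  exact ((h.comp spatial.continuous).sub (by fun_prop)).continuousAt

/-- On the axis through the poles `γ = -x₀ / |x| = ±1`. This keeps the possible singularities of `γ`
away from the moving boundary at times in `(0, π)`. -/
theorem spatial_ne_zero_of_sq_ne_one {x : E4} (hx : x ≠ 0) (h : obstacleFun φ x ^ 2 ≠ 1) :
    spatial x ≠ 0 := by
  intro h0
  apply h
  have h1 := norm_sq_eq_spatial x
  rw [h0, norm_zero] at h1
  rw [obstacleFun, h0, starGauge_zero, div_pow, zero_sub, neg_sq, h1]
  have : ‖x‖ ^ 2 ≠ 0 := pow_ne_zero 2 (norm_ne_zero_iff.2 hx)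
  rw [h1] at this
  simpa using div_self this

theorem contDiffAt_obstacleFun (hφs : ContMDiff (𝓡 2) 𝓘(ℝ, ℝ) ∞ φ) (hφ : ∀ θ, 0 < φ θ) {x : E4}
    (hx : x ≠ 0) (hx' : spatial x ≠ 0) : ContDiffAt ℝ 1 (obstacleFun φ) x := by
  refine ContDiffAt.div ?_ (contDiffAt_norm ℝ hx) (norm_ne_zero_iff.2 hx)
  refine ((contDiffAt_starGauge hφs hφ hx').comp x spatial.contDiff.contDiffAt).sub ?_
  exact (EuclideanSpace.proj (𝕜 := ℝ) (0 : Fin 4)).contDiff.contDiffAt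

/-- Euler's relation in degree zero. -/
theorem fderiv_apply_self_of_homogeneous {E : Type*} [NormedAddCommGroup E] [NormedSpace ℝ E]
    {f : E → ℝ} (hf : ∀ c : ℝ, 0 < c → ∀ x, f (c • x) = f x) {x : E}
    (hd : DifferentiableAt ℝ f x) : fderiv ℝ f x x = 0 := by
  have h1 : HasDerivAt (fun c : ℝ => f (c • x)) (fderiv ℝ f x x) 1 := by
    have h2 : HasDerivAt (fun c : ℝ => c • x) x 1 := by
      simpa using (hasDerivAt_id (1 : ℝ)).smul_const x
    have h3 : HasFDerivAt f (fderiv ℝ f x) ((1 : ℝ) • x) := by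
      rw [one_smul]; exact hd.hasFDerivAt
    exact h3.comp_hasDerivAt (1 : ℝ) h2
  refine h1.unique ((hasDerivAt_const (1 : ℝ) (f x)).congr_of_eventuallyEq ?_)
  filter_upwards [lt_mem_nhds (zero_lt_one (α := ℝ))] with c hc using hf c hc x

/-- This is the causality of the boundary. The vector `|x|∇γ + γ x/|x|` is the Euclidean gradient of
`|x|γ`, whose component along the polar axis is `-1`, so its length is at least 1. By Euler's
relation its two terms are orthogonal, and Pythagoras gives the bound. -/
theorem one_sub_sq_le_gradient (hφs : ContMDiff (𝓡 2) 𝓘(ℝ, ℝ) ∞ φ) (hφ : ∀ θ, 0 < φ θ) {x : E4}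
    (hx : x ≠ 0) (hx' : spatial x ≠ 0) {ι : Type*} [Fintype ι] (b : OrthonormalBasis ι ℝ E4) :
    1 - obstacleFun φ x ^ 2 ≤ ‖x‖ ^ 2 * ∑ i, fderiv ℝ (obstacleFun φ) x (b i) ^ 2 := by
  have hd := (contDiffAt_obstacleFun hφs hφ hx hx').differentiableAt (by norm_num)
  have hrad := fderiv_apply_self_of_homogeneous (fun c hc x => obstacleFun_smul (φ := φ) hc x) hd
  set ℓ : E4 := gradient (obstacleFun φ) x with hℓ
  have hin : ∀ y, inner ℝ ℓ y = fderiv ℝ (obstacleFun φ) x y := fun y => by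
    rw [hℓ, gradient, InnerProductSpace.toDual_symm_apply]
  have hn : ‖x‖ ≠ 0 := norm_ne_zero_iff.2 hx
  have hsum : ∑ i, fderiv ℝ (obstacleFun φ) x (b i) ^ 2 = ‖ℓ‖ ^ 2 := by
    rw [← b.sum_sq_norm_inner_left ℓ]
    simp [hin]
  -- Differentiate `|x| γ = starGauge (spatial x) - x₀` along the polar axis, on which `spatial` is
  -- constant.
  have hpole : ‖x‖ * fderiv ℝ (obstacleFun φ) x northPole + obstacleFun φ x * (x 0 / ‖x‖) = -1 := by
    have h1 : HasFDerivAt (fun y => ‖y‖ * obstacleFun φ y) _ x :=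
      ((contDiffAt_norm ℝ hx (n := 1)).differentiableAt (by norm_num)).hasFDerivAt.fun_mul
        hd.hasFDerivAt
    have h2 : HasFDerivAt (fun y => starGauge φ (spatial y) - y 0) _ x :=
      (((contDiffAt_starGauge hφs hφ hx').differentiableAt (by norm_num)).hasFDerivAt.comp x
        spatial.hasFDerivAt).sub (EuclideanSpace.proj (𝕜 := ℝ) (0 : Fin 4)).hasFDerivAt
    have h3 : (fun y => ‖y‖ * obstacleFun φ y) =ᶠ[𝓝 x] fun y => starGauge φ (spatial y) - y 0 := by
      filter_upwards [isOpen_ne.mem_nhds hx] with y hy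
      rw [obstacleFun, mul_div_cancel₀ _ (norm_ne_zero_iff.2 hy)]
    have h4 := congrArg (fun L : E4 →L[ℝ] ℝ => L northPole)
      (h1.unique (h2.congr_of_eventuallyEq h3))
    have h5 : fderiv ℝ (fun y : E4 => ‖y‖) x northPole = x 0 / ‖x‖ := by
      have h6 := ((contDiffAt_norm ℝ hx (n := 1)).differentiableAt (by norm_num)).hasFDerivAt.pow 2
      have h7 := congrArg (fun L : E4 →L[ℝ] ℝ => L northPole)
        (h6.unique (hasStrictFDerivAt_norm_sq x).hasFDerivAt)
      simp [northPole, EuclideanSpace.inner_single_right] at h7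
      rw [eq_div_iff (norm_ne_zero_iff.2 hx), mul_comm]
      change ‖x‖ * fderiv ℝ norm x (EuclideanSpace.single 0 1) = x 0
      linarith
    simp at h4
    rw [h5] at h4
    simpa [northPole] using h4
  rw [hsum]
  have h6 : ‖‖x‖ • ℓ + (obstacleFun φ x / ‖x‖) • x‖ ^ 2 = ‖x‖ ^ 2 * ‖ℓ‖ ^ 2 + obstacleFun φ x ^ 2 := by
    rw [norm_add_sq_real, inner_smul_left, inner_smul_right, hin, hrad, norm_smul, norm_smul]
    simp [mul_pow, hn]
  have h7 : inner ℝ (‖x‖ • ℓ + (obstacleFun φ x / ‖x‖) • x) northPole = -1 := by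
    rw [inner_add_left, inner_smul_left, inner_smul_left, hin]
    simp only [northPole, EuclideanSpace.inner_single_right] at hpole ⊢
    simp
    linear_combination hpole
  have h8 := abs_real_inner_le_norm (‖x‖ • ℓ + (obstacleFun φ x / ‖x‖) • x) northPole
  rw [h7, abs_neg, abs_one, show ‖northPole‖ = 1 by simp [northPole], mul_one] at h8
  nlinarith

end Gauge

/-! ### The level set `γ = 1` is negligible. -/

section NullSet

variable {φ : S2 → ℝ}

/-- Fubini along lines parallel to the polar axis. With `N > 0` the gauge, constant on such a line,
squaring `N - x₀ = |x|` cancels `x₀²` and leaves an equation of degree one in `x₀`, so each line off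
the axis meets the set at most once. The axis itself is a proper subspace. -/
theorem ae_obstacleFun_ne_one (hφs : ContMDiff (𝓡 2) 𝓘(ℝ, ℝ) ∞ φ) (hφ : ∀ θ, 0 < φ θ) :
    ∀ᵐ x : E4, obstacleFun φ x ≠ 1 := by
  have hc := continuous_starGauge hφs hφ
  set s : Set E4 := {x | spatial x = 0} ∪ {x | starGauge φ (spatial x) - x 0 = ‖x‖}ᶜ with hs
  have hsm : MeasurableSet s := by
    refine (isClosed_eq spatial.continuous continuous_const).measurableSet.union
      (IsClosed.measurableSet ?_).compl
    exact isClosed_eq ((hc.comp spatial.continuous).sub (by fun_prop)) continuous_norm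
  have h1 : ∀ᵐ x : E4, x ∈ s := by
    refine ae_mem_of_ae_add_linearMap_mem
      (LinearMap.toSpanSingleton ℝ E4 northPole) volume volume hsm fun y => ?_
    by_cases hy : spatial y = 0
    · exact ae_of_all _ fun t => Or.inl (by simp [hy])
    · have hsub : {t : ℝ | y + t • northPole ∉ s}.Subsingleton := by
        have key : ∀ t : ℝ, y + t • northPole ∉ s →
            starGauge φ (spatial y) ^ 2 - 2 * starGauge φ (spatial y) * (y 0 + t) =
              ‖spatial y‖ ^ 2 := by
          intro t ht
          simp only [hs, mem_union, not_or, mem_ofPred_eq, mem_compl_iff, not_not, map_add, map_smul,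
            spatial_northPole, smul_zero, add_zero] at ht
          have h2 := norm_sq_eq_spatial (y + t • northPole)
          rw [← ht.2] at h2
          simp [northPole, -PiLp.add_apply] at h2
          have h4 : spatial (EuclideanSpace.single 0 1) = 0 := spatial_northPole
          rw [h4, smul_zero, add_zero] at h2
          linarith
        intro t ht t' ht'
        have h2 := key t ht
        have h3 := key t' ht'
        have h4 := (starGauge_pos hφ hy).ne'
        have h5 : starGauge φ (spatial y) * t = starGauge φ (spatial y) * t' := by linarith
        exact mul_left_cancel₀ h4 h5
      have h0 : (volume : Measure ℝ) {t : ℝ | y + t • northPole ∉ s} = 0 :=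
        hsub.countable.measure_zero _
      exact h0
  have h2 : ∀ᵐ x : E4, spatial x ≠ 0 := by
    have : volume ((LinearMap.ker (spatial : E4 →ₗ[ℝ] E3) : Submodule ℝ E4) : Set E4) = 0 := by
      refine Measure.addHaar_submodule _ _ fun htop => ?_
      have h3 : EuclideanSpace.single (1 : Fin 4) (1 : ℝ) ∈
          LinearMap.ker (spatial : E4 →ₗ[ℝ] E3) := by rw [htop]; trivial
      have h4 : spatial (EuclideanSpace.single (1 : Fin 4) (1 : ℝ)) 0 = 0 := by
        have := LinearMap.mem_ker.1 h3
        exact congrArg (fun y : E3 => y 0) this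
      rw [spatial_apply] at h4
      simp at h4
    refine measure_mono_null ?_ this
    intro x hx
    simpa using hx
  filter_upwards [h1, h2] with x hx hx' h
  have hx0 : x ≠ 0 := by rintro rfl; simp at hx'
  rw [obstacleFun, div_eq_one_iff_eq (norm_ne_zero_iff.2 hx0)] at h
  rcases hx with hx | hx
  · exact hx' hx
  · exact hx h

/-- Surface measure is a multiple of the volume of the truncated cone over a set, and by homogeneity
the cone lies in the null set found in `ℝ⁴`. -/
theorem ae_sphere_obstacleFun_ne_one (hφs : ContMDiff (𝓡 2) 𝓘(ℝ, ℝ) ∞ φ) (hφ : ∀ θ, 0 < φ θ) :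
    ∀ᵐ X : S3 ∂(volume : Measure E4).toSphere, obstacleFun φ (X : E4) ≠ 1 := by
  have hm : MeasurableSet {X : S3 | obstacleFun φ (X : E4) = 1} := by
    refine (isClosed_eq ?_ continuous_const).measurableSet
    refine continuous_iff_continuousAt.2 fun X => ?_
    exact ContinuousAt.comp (f := fun X : S3 => (X : E4))
      (continuousAt_obstacleFun hφs hφ (ne_zero_of_mem_unit_sphere X))
      continuous_subtype_val.continuousAt
  rw [ae_iff]
  simp only [ne_eq, not_not]
  rw [Measure.toSphere_apply' _ hm, mul_eq_zero]
  right
  refine measure_mono_null ?_ (ae_obstacleFun_ne_one hφs hφ)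
  rintro _ ⟨r, hr, _, ⟨X, hX, rfl⟩, rfl⟩
  simp only [mem_compl_iff, mem_ofPred_eq, not_not] at hX ⊢
  simpa [obstacleFun_smul hr.1] using hX

end NullSet

/-! ### Passing between integrals over an annulus and over the sphere. -/

section Polar

/-- A radial bump function on `ℝ⁴`, supported in an annulus. -/
def annulusBump (x : E4) : ℝ :=
  (⟨1 / 4, 1 / 2, by norm_num, by norm_num⟩ : ContDiffBump (1 : ℝ)) (‖x‖ ^ 2)

theorem contDiff_annulusBump : ContDiff ℝ 1 annulusBump :=
  (ContDiffBump.contDiff _).comp (contDiff_norm_sq ℝ)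

theorem annulusBump_nonneg (x : E4) : 0 ≤ annulusBump x := ContDiffBump.nonneg _

theorem annulusBump_eq_zero {x : E4} (hx : ‖x‖ ^ 2 ≤ 1 / 2 ∨ 3 / 2 ≤ ‖x‖ ^ 2) :
    annulusBump x = 0 := by
  refine ContDiffBump.zero_of_le_dist _ ?_
  change 1 / 2 ≤ _
  rw [Real.dist_eq, le_abs]
  rcases hx with h | h
  · right; linarith
  · left; linarith

theorem hasCompactSupport_annulusBump : HasCompactSupport annulusBump := by
  refine HasCompactSupport.intro (isCompact_closedBall 0 2) fun x hx => annulusBump_eq_zero ?_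
  right
  have : 2 < ‖x‖ := by simpa using hx
  nlinarith

theorem annulusBump_eq_one {x : E4} (hx : ‖x‖ = 1) : annulusBump x = 1 :=
  ContDiffBump.one_of_mem_closedBall _ (by simp [hx])

theorem lintegral_radial_mul (h : ℝ → ℝ≥0∞) (hh : Measurable h) {f : S3 → ℝ≥0∞}
    (hf : Measurable f) :
    ∫⁻ x : E4, h ‖x‖ * f (radialProj x) =
      (∫⁻ r, h r ∂Measure.volumeIoiPow 3) * ∫⁻ X, f X ∂(volume : Measure E4).toSphere := by
  have hmp := (volume : Measure E4).measurePreserving_homeomorphUnitSphereProd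
  have hdim : Module.finrank ℝ E4 - 1 = 3 := by simp
  rw [hdim] at hmp
  have hmeas : Measurable fun p : S3 × Ioi (0 : ℝ) => f p.1 * h p.2 :=
    (hf.comp measurable_fst).mul (hh.comp (measurable_subtype_coe.comp measurable_snd))
  have h1 := hmp.lintegral_comp hmeas
  rw [lintegral_prod_mul (g := fun r : Ioi (0 : ℝ) => h r) hf.aemeasurable
    (hh.comp measurable_subtype_coe).aemeasurable] at h1
  rw [mul_comm]
  refine Eq.trans ?_ h1
  have h2 : ∫⁻ x : E4, h ‖x‖ * f (radialProj x) = ∫⁻ x in ({0}ᶜ : Set E4), h ‖x‖ * f (radialProj x) := by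
    rw [restrict_compl_singleton]
  rw [h2, ← lintegral_subtype_comap (measurableSet_singleton _).compl]
  refine lintegral_congr fun x => ?_
  rw [mul_comm]
  congr 2
  · apply Subtype.ext
    rw [coe_radialProj x.2]
    simp
  · simp

/-- The constant is the radial integral of the bump. Testing with `f = 1` shows that it is neither 0
nor infinite, so that it can be cancelled at the end. -/
theorem exists_lintegral_annulusBump_mul :
    ∃ c : ℝ≥0∞, c ≠ 0 ∧ c ≠ ⊤ ∧ ∀ f : S3 → ℝ≥0∞, Measurable f →
      ∫⁻ x : E4, ENNReal.ofReal (annulusBump x) * f (radialProj x) =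
        c * ∫⁻ X, f X ∂(volume : Measure E4).toSphere := by
  set h : ℝ → ℝ≥0∞ := fun r => ENNReal.ofReal
    ((⟨1 / 4, 1 / 2, by norm_num, by norm_num⟩ : ContDiffBump (1 : ℝ)) (r ^ 2)) with hh
  have hm : Measurable h := by
    refine ENNReal.measurable_ofReal.comp (Continuous.measurable ?_)
    exact (ContDiffBump.continuous _).comp (continuous_pow 2)
  have key := fun f hf => lintegral_radial_mul h hm (f := f) hf
  have h1 := key (fun _ => 1) measurable_const
  simp only [mul_one, lintegral_const, one_mul] at h1
  have hcont : Continuous annulusBump := contDiff_annulusBump.continuous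
  have hint : Integrable annulusBump (volume : Measure E4) :=
    hcont.integrable_of_hasCompactSupport hasCompactSupport_annulusBump
  have h2 : ∫⁻ x : E4, h ‖x‖ = ENNReal.ofReal (∫ x, annulusBump x) :=
    (ofReal_integral_eq_lintegral_ofReal hint (ae_of_all _ annulusBump_nonneg)).symm
  have h3 : 0 < ∫ x, annulusBump x := by
    refine hcont.integral_pos_of_hasCompactSupport_nonneg_nonzero (x := northPole)
      hasCompactSupport_annulusBump annulusBump_nonneg ?_
    rw [annulusBump_eq_one (by simp [northPole])]
    norm_num
  refine ⟨∫⁻ r, h r ∂Measure.volumeIoiPow 3, ?_, ?_, key⟩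
  · intro h0
    rw [h0, zero_mul, h2, ENNReal.ofReal_eq_zero] at h1
    linarith
  · intro h0
    rw [h0, ENNReal.top_mul, h2] at h1
    · exact ENNReal.ofReal_ne_top h1
    · rw [Measure.measure_univ_ne_zero]
      exact Measure.toSphere_ne_zero _

end Polar

/-! ### The transformed obstacle as a sublevel set. -/

section Exterior

variable {φ : S2 → ℝ} {K : Set E3}

theorem mem_starShaped_iff (hφ : ∀ θ, 0 < φ θ)
    (hK : K = {x | ∃ (r : ℝ) (θ : S2), 0 ≤ r ∧ r ≤ φ θ ∧ x = r • (θ : E3)}) (x : E3) :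
    x ∈ K ↔ starGauge φ x ≤ 1 := by
  rw [hK]
  constructor
  · rintro ⟨r, θ, hr, hrφ, rfl⟩
    rcases hr.eq_or_lt with rfl | hr
    · simp
    · have h1 : radialProj3 (θ : E3) = θ := by
        have h : ‖(θ : E3)‖ = 1 := by simp
        apply Subtype.ext
        rw [coe_radialProj3 (norm_ne_zero_iff.1 (by rw [h]; norm_num)), h, inv_one, one_smul]
      rw [starGauge_smul hr, starGauge, h1]
      simpa [div_eq_mul_inv] using (div_le_one (hφ θ)).2 hrφ
  · intro h
    by_cases hx : x = 0
    · exact ⟨0, radialProj3 0, le_rfl, (hφ _).le, by simp [hx]⟩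
    · refine ⟨‖x‖, radialProj3 x, norm_nonneg _, (div_le_one (hφ _)).1 h, ?_⟩
      rw [coe_radialProj3 hx, smul_smul, mul_inv_cancel₀ (norm_ne_zero_iff.2 hx), one_smul]

theorem polarPoint_zero_coord {R : ℝ} {x : E3} (h : x = 0 → R = 0) :
    (polarPoint R x : E4) 0 = Real.cos R := by
  by_cases hx : x = 0
  · simp [polarPoint, hx, h hx]
  · simp [polarPoint, hx]

theorem spatial_polarPoint {R : ℝ} {x : E3} (hx : x ≠ 0) :
    spatial (polarPoint R x : E4) = (Real.sin R / ‖x‖) • x := by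
  ext i
  fin_cases i <;> simp [polarPoint, hx, Fin.succ] <;> ring

theorem sin_arctan_eq (s : ℝ) : Real.sin (Real.arctan s) = s * Real.cos (Real.arctan s) := by
  have h := Real.tan_arctan s
  rw [Real.tan_eq_sin_div_cos, div_eq_iff (Real.cos_arctan_pos s).ne'] at h
  exact h

/-- With `α = arctan (t + r)` and `β = arctan (t - r)`, the conformal factor is `Ω = cos R + cos T =
2 cos α cos β > 0`, and `sin R = Ω r`. Thus the last three coordinates of the image of `(t, x)` are
`Ω x`, and the gauge scales by `Ω`. -/
theorem mem_transformedObstacle_iff (hφ : ∀ θ, 0 < φ θ)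
    (hK : K = {x | ∃ (r : ℝ) (θ : S2), 0 ≤ r ∧ r ≤ φ θ ∧ x = r • (θ : E3)}) (T : ℝ) (X : S3) :
    (T, X) ∈ transformedObstacle K ↔ 0 ≤ T ∧ T < Real.pi ∧
      starGauge φ (spatial X) ≤ (X : E4) 0 + Real.cos T ∧ 0 < (X : E4) 0 + Real.cos T := by
  constructor
  · rintro ⟨⟨t, x⟩, ⟨ht, hx⟩, hp⟩
    rw [mem_starShaped_iff hφ hK] at hx
    simp only [penrose, Prod.mk.injEq] at hp
    obtain ⟨rfl, rfl⟩ := hp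
    simp only [mem_Ici] at ht
    set α := Real.arctan (t + ‖x‖) with hα
    set β := Real.arctan (t - ‖x‖) with hβ
    have hcα : 0 < Real.cos α := Real.cos_arctan_pos _
    have hcβ : 0 < Real.cos β := Real.cos_arctan_pos _
    have hX0 : (polarPoint (α - β) x : E4) 0 = Real.cos (α - β) :=
      polarPoint_zero_coord (by rintro rfl; simp [hα, hβ])
    have hΩ : Real.cos (α - β) + Real.cos (α + β) = 2 * Real.cos α * Real.cos β := by
      rw [Real.cos_sub, Real.cos_add]; ring
    rw [hX0, hΩ]
    have hΩ0 : 0 < 2 * Real.cos α * Real.cos β := by positivity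
    have hX' : starGauge φ (spatial (polarPoint (α - β) x)) =
        2 * Real.cos α * Real.cos β * starGauge φ x := by
      by_cases h0 : x = 0
      · have : spatial (polarPoint (α - β) x : E4) = 0 := by
          ext i
          fin_cases i <;> simp [polarPoint, h0, Fin.succ]
        rw [this, h0]; simp
      · rw [spatial_polarPoint h0, ← starGauge_smul hΩ0]
        congr 2
        rw [div_eq_iff (norm_ne_zero_iff.2 h0), Real.sin_sub, hα, hβ, sin_arctan_eq, sin_arctan_eq]
        ring
    refine ⟨?_, ?_, ?_, hΩ0⟩
    · have : Real.arctan (‖x‖ - t) ≤ α := Real.arctan_strictMono.monotone (by linarith)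
      rw [show ‖x‖ - t = -(t - ‖x‖) by ring, Real.arctan_neg] at this
      linarith
    · have h1 := Real.arctan_lt_pi_div_two (t + ‖x‖)
      have h2 := Real.arctan_lt_pi_div_two (t - ‖x‖)
      linarith
    · rw [hX']
      exact mul_le_of_le_one_right hΩ0.le hx
  · rintro ⟨hT0, hTpi, hN, hΩ⟩
    have hn := norm_sq_eq_spatial (X : E4)
    rw [show ‖(X : E4)‖ = 1 by simp] at hn
    have hX1 : (X : E4) 0 ≤ 1 := by nlinarith [sq_nonneg ‖spatial (X : E4)‖]
    have hX2 : -1 ≤ (X : E4) 0 := by nlinarith [sq_nonneg ‖spatial (X : E4)‖]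
    set R := Real.arccos ((X : E4) 0) with hR
    have hcR : Real.cos R = (X : E4) 0 := Real.cos_arccos hX2 hX1
    have hsR : Real.sin R = ‖spatial (X : E4)‖ := by
      rw [hR, Real.sin_arccos, show 1 - (X : E4) 0 ^ 2 = ‖spatial (X : E4)‖ ^ 2 by linarith,
        Real.sqrt_sq (norm_nonneg _)]
    have hR0 : 0 ≤ R := Real.arccos_nonneg _
    have hRpi : R ≤ Real.pi := Real.arccos_le_pi _
    rw [← hcR] at hN hΩ
    set Ω := Real.cos R + Real.cos T with hΩdef
    -- Positivity of `Ω` means `T + R < π`, which places `(T ± R) / 2` in the range of `arctan`.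
    have hTR : R < Real.pi - T := by
      refine (Real.strictAntiOn_cos.lt_iff_gt ⟨by linarith, by linarith⟩ ⟨hR0, hRpi⟩).1 ?_
      rw [Real.cos_pi_sub]; linarith
    set α := (T + R) / 2 with hα
    set β := (T - R) / 2 with hβ
    have hcα : 0 < Real.cos α := Real.cos_pos_of_mem_Ioo ⟨by linarith [Real.pi_pos], by linarith⟩
    have hcβ : 0 < Real.cos β := Real.cos_pos_of_mem_Ioo ⟨by linarith [Real.pi_pos], by linarith⟩
    have eT : T = α + β := by rw [hα, hβ]; ring
    have eR : R = α - β := by rw [hα, hβ]; ring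
    have eΩ : Ω = 2 * Real.cos α * Real.cos β := by
      rw [hΩdef, eT, eR, Real.cos_sub, Real.cos_add]; ring
    -- The inverse of the Penrose map: `t = sin T / Ω`, `r = sin R / Ω`.
    refine ⟨(Real.sin T / Ω, Ω⁻¹ • spatial (X : E4)), ⟨?_, ?_⟩, ?_⟩
    · exact div_nonneg (Real.sin_nonneg_of_nonneg_of_le_pi hT0 hTpi.le) hΩ.le
    · rw [mem_starShaped_iff hφ hK, starGauge_smul (inv_pos.2 hΩ), inv_mul_le_iff₀ hΩ, mul_one]
      exact hN
    · have hnx : ‖Ω⁻¹ • spatial (X : E4)‖ = Real.sin R / Ω := by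
        rw [norm_smul, Real.norm_of_nonneg (inv_nonneg.2 hΩ.le), hsR]; ring
      have hp : Real.arctan (Real.sin T / Ω + Real.sin R / Ω) = α := by
        refine Real.arctan_eq_of_tan_eq ?_ ⟨by linarith [Real.pi_pos], by linarith⟩
        rw [Real.tan_eq_sin_div_cos, ← add_div, eΩ]
        conv_rhs => rw [eT, eR, Real.sin_add, Real.sin_sub]
        field_simp
        ring
      have hm : Real.arctan (Real.sin T / Ω - Real.sin R / Ω) = β := by
        refine Real.arctan_eq_of_tan_eq ?_ ⟨by linarith [Real.pi_pos], by linarith⟩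
        rw [Real.tan_eq_sin_div_cos, ← sub_div, eΩ]
        conv_rhs => rw [eT, eR, Real.sin_add, Real.sin_sub]
        field_simp
        ring
      simp only [penrose, hnx, hp, hm, ← eT, ← eR, Prod.mk.injEq, true_and]
      have hdec : ∀ Z : S3, (Z : E4) 0 = (X : E4) 0 → spatial (Z : E4) = spatial (X : E4) →
          Z = X := by
        intro Z h0 h1
        apply Subtype.ext
        ext i
        refine Fin.cases h0 (fun j => ?_) i
        exact congrArg (fun y : E3 => y j) h1
      by_cases h0 : spatial (X : E4) = 0
      · have h1 : (X : E4) 0 = 1 := by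
          rw [h0, norm_zero] at hn
          have : ((X : E4) 0 - 1) * ((X : E4) 0 + 1) = 0 := by linarith
          rcases mul_eq_zero.1 this with h | h
          · linarith
          · have := Real.cos_le_one T
            rw [hΩdef, hcR] at hΩ
            linarith
        have hR' : R = 0 := by rw [hR, h1, Real.arccos_one]
        refine hdec _ ?_ ?_
        · rw [polarPoint_zero_coord fun _ => hR', hcR]
        · rw [h0]
          ext i
          fin_cases i <;> simp [polarPoint, Fin.succ]
      · have hx0 : Ω⁻¹ • spatial (X : E4) ≠ 0 := smul_ne_zero (inv_ne_zero hΩ.ne') h0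
        refine hdec _ ?_ ?_
        · rw [polarPoint_zero_coord fun h => absurd h hx0, hcR]
        · rw [spatial_polarPoint hx0, hnx, smul_smul]
          have : Real.sin R ≠ 0 := by rw [hsR]; exact norm_ne_zero_iff.2 h0
          rw [show Real.sin R / (Real.sin R / Ω) * Ω⁻¹ = 1 by field_simp, one_smul]

/-- The condition `0 < Ω` is implied by the gauge inequality except where the gauge and `Ω` both
vanish, that is, at the south pole at time 0. That point (spatial infinity) belongs to `Y` although
`γ = cos T` there, and the last hypothesis excludes it. -/
theorem mem_exterior_iff (hφ : ∀ θ, 0 < φ θ)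
    (hK : K = {x | ∃ (r : ℝ) (θ : S2), 0 ≤ r ∧ r ≤ φ θ ∧ x = r • (θ : E3)}) {T : ℝ} (hT0 : 0 ≤ T)
    (hTpi : T < Real.pi) (X : S3) (h : 0 < T ∨ obstacleFun φ (X : E4) ≠ 1) :
    (T, X) ∈ exterior K ↔ Real.cos T < obstacleFun φ (X : E4) := by
  have hn := norm_sq_eq_spatial (X : E4)
  rw [show ‖(X : E4)‖ = 1 by simp] at hn
  have e : obstacleFun φ (X : E4) = starGauge φ (spatial (X : E4)) - (X : E4) 0 := by
    rw [obstacleFun]; simp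
  rw [exterior, Set.mem_sdiff, mem_transformedObstacle_iff hφ hK]
  simp only [slab, mem_prod, mem_Ico, mem_univ, and_true, hT0, hTpi, true_and, not_and, not_lt]
  have hN := starGauge_nonneg hφ (spatial (X : E4))
  constructor
  · intro h1
    by_contra! h2
    have h3 := h1 (by linarith)
    have h4 : starGauge φ (spatial (X : E4)) = 0 := by linarith
    have h5 : spatial (X : E4) = 0 := by
      by_contra h5
      exact (starGauge_pos hφ h5).ne' h4
    rw [h5, norm_zero] at hn
    have hx : (X : E4) 0 = -1 := by
      have : ((X : E4) 0 - 1) * ((X : E4) 0 + 1) = 0 := by linarith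
      rcases mul_eq_zero.1 this with h6 | h6
      · have : -1 < Real.cos T := by
          rw [← Real.cos_pi]
          exact Real.cos_lt_cos_of_nonneg_of_le_pi hT0 le_rfl hTpi
        linarith
      · linarith
    rw [hx, h4] at e
    rcases h with h | h
    · have : Real.cos T < 1 := by
        rw [← Real.cos_zero]
        exact Real.cos_lt_cos_of_nonneg_of_le_pi le_rfl hTpi.le h
      linarith
    · exact h (by linarith)
  · intro h1 h2
    linarith

end Exterior

/-! ### Invariance under spatial dilations. -/

section Homogeneous

variable {E : Type*} [NormedAddCommGroup E] [InnerProductSpace ℝ E]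
  {ι : Type*} [Fintype ι] {b : OrthonormalBasis ι ℝ E}

/-- The dilation `(T, x) ↦ (T, c x)`. -/
def dilation (c : ℝ) (hc : c ≠ 0) : (ℝ × E) ≃L[ℝ] (ℝ × E) :=
  (ContinuousLinearEquiv.refl ℝ ℝ).prodCongr (ContinuousLinearEquiv.smulLeft (Units.mk0 c hc))

theorem dilation_apply (c : ℝ) (hc : c ≠ 0) (z : ℝ × E) :
    dilation c hc z = (z.1, c • z.2) := rfl

theorem fderiv_dilation {c : ℝ} (hc : c ≠ 0) {a : ℝ} {f : ℝ × E → ℝ}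
    (hf : ∀ z, f (dilation c hc z) = a * f z) (z y : ℝ × E) :
    fderiv ℝ f (dilation c hc z) (dilation c hc y) = a * fderiv ℝ f z y := by
  have h1 : f ∘ dilation c hc = fun z => a * f z := funext hf
  have h2 := (dilation (E := E) c hc).comp_right_fderiv (f := f) (x := z)
  have h3 : fderiv ℝ (fun z => a * f z) z = a • fderiv ℝ f z := by
    exact congrFun (fderiv_const_smul_field (f := f) a) z
  rw [h1, h3] at h2
  exact (congrArg (fun L : ℝ × E →L[ℝ] ℝ => L y) h2).symm

theorem partialT_dilation {c : ℝ} (hc : c ≠ 0) {a : ℝ} {f : ℝ × E → ℝ}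
    (hf : ∀ z, f (dilation c hc z) = a * f z) (z : ℝ × E) :
    partialT f (dilation c hc z) = a * partialT f z := by
  have := fderiv_dilation hc hf z (1, 0)
  rwa [dilation_apply c hc (1, 0), smul_zero] at this

theorem partialX_dilation {c : ℝ} (hc : c ≠ 0) {a : ℝ} {f : ℝ × E → ℝ}
    (hf : ∀ z, f (dilation c hc z) = a * f z) (i : ι) (z : ℝ × E) :
    partialX b f i (dilation c hc z) = a * c⁻¹ * partialX b f i z := by
  have := fderiv_dilation hc hf z (0, c⁻¹ • b i)
  rw [dilation_apply c hc (0, c⁻¹ • b i), smul_smul, mul_inv_cancel₀ hc, one_smul] at this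
  rw [partialX, this, show ((0 : ℝ), c⁻¹ • b i) = c⁻¹ • ((0 : ℝ), b i) by simp, map_smul,
    smul_eq_mul, mul_assoc]
  rfl

/-- Each spatial derivative gains a factor `c⁻¹`, and the weight `|x|²` compensates for the two of
them. -/
theorem energyDensity_dilation {c : ℝ} (hc : c ≠ 0) {f : ℝ × E → ℝ}
    (hf : ∀ z, f (dilation c hc z) = f z) (z : ℝ × E) :
    energyDensity b f (dilation c hc z) = energyDensity b f z := by
  have hf' : ∀ z, f (dilation c hc z) = 1 * f z := by simpa using hf
  simp only [energyDensity, partialT_dilation hc hf', partialX_dilation hc hf', one_mul]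
  simp only [dilation_apply, norm_smul, mul_pow, ← Finset.mul_sum, Real.norm_eq_abs, sq_abs]
  field_simp

theorem conicalWaveOp_dilation {c : ℝ} (hc : c ≠ 0) {f : ℝ × E → ℝ}
    (hf : ∀ z, f (dilation c hc z) = f z) (z : ℝ × E) :
    conicalWaveOp b f (dilation c hc z) = conicalWaveOp b f z := by
  have hf' : ∀ z, f (dilation c hc z) = 1 * f z := by simpa using hf
  have hX := fun i => partialX_dilation (b := b) hc (partialX_dilation (b := b) hc hf' i) i z
  simp only [conicalWaveOp, partialT_dilation hc (partialT_dilation hc hf'), hX, one_mul]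
  simp only [dilation_apply, norm_smul, mul_pow, ← Finset.mul_sum, Real.norm_eq_abs, sq_abs]
  field_simp

end Homogeneous

/-! ### The homogeneous extension of `u` on the cone over `Y`. -/

section Pullback

/-- The extension of a function on `ℝ × S³` to `ℝ × ℝ⁴` by homogeneity of degree zero. -/
def radialExt (u : ℝ × S3 → ℝ) (z : ℝ × E4) : ℝ := u (z.1, radialProj z.2)

/-- The cone over `Y ∪ ∂Y`. -/
def coneClosure (K : Set E3) : Set (ℝ × E4) :=
  {z | z.2 ≠ 0 ∧ (z.1, radialProj z.2) ∈ exteriorClosure K}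

/-- The cone over `Y`, up to a null set at time `0`. -/
def coneExterior (φ : S2 → ℝ) : Set (ℝ × E4) :=
  {z | 0 ≤ z.1 ∧ z.1 < Real.pi ∧ z.2 ≠ 0 ∧ Real.cos z.1 < obstacleFun φ z.2}

variable {u : ℝ × S3 → ℝ} {K : Set E3} {φ : S2 → ℝ}

theorem contDiffOn_radialExt
    (hu : ContMDiffOn (𝓘(ℝ, ℝ).prod (𝓡 3)) 𝓘(ℝ, ℝ) 2 u (exteriorClosure K)) :
    ContDiffOn ℝ 2 (radialExt u) (coneClosure K) := by
  intro z hz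
  rw [← contMDiffWithinAt_iff_contDiffWithinAt]
  have h1 : ContMDiffAt 𝓘(ℝ, ℝ × E4) (𝓘(ℝ, ℝ).prod (𝓡 3)) 2
      (fun y : ℝ × E4 => (y.1, radialProj y.2)) z := by
    refine ContMDiffAt.prodMk ?_ ?_
    · exact contMDiffAt_iff_contDiffAt.2 contDiffAt_fst
    · exact (contMDiffAt_radialProj hz.1).comp z (contMDiffAt_iff_contDiffAt.2 contDiffAt_snd)
  exact (hu _ hz.2).comp z h1.contMDiffWithinAt (fun y hy => hy.2)

theorem radialExt_dilation {c : ℝ} (hc : 0 < c) (z : ℝ × E4) :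
    radialExt u (dilation c hc.ne' z) = radialExt u z := by
  simp [radialExt, dilation_apply, radialProj_smul hc]

theorem obstacleFun_radialProj {x : E4} (hx : x ≠ 0) :
    obstacleFun φ (radialProj x : E4) = obstacleFun φ x := by
  rw [coe_radialProj hx, obstacleFun_smul (inv_pos.2 (norm_pos_iff.2 hx))]

section

variable (hφs : ContMDiff (𝓡 2) 𝓘(ℝ, ℝ) ∞ φ) (hφ : ∀ θ, 0 < φ θ)
  (hK : K = {x | ∃ (r : ℝ) (θ : S2), 0 ≤ r ∧ r ≤ φ θ ∧ x = r • (θ : E3)})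

include hφ hK

theorem mem_exterior_of_mem_cone {z : ℝ × E4} (hz : z ∈ coneExterior φ) :
    (z.1, radialProj z.2) ∈ exterior K := by
  obtain ⟨h0, hpi, hx, hlt⟩ := hz
  refine (mem_exterior_iff hφ hK h0 hpi _ ?_).2 (by rwa [obstacleFun_radialProj hx])
  rcases h0.eq_or_lt with h | h
  · right
    rw [obstacleFun_radialProj hx]
    rw [← h, Real.cos_zero] at hlt
    exact hlt.ne'
  · exact Or.inl h

/-- Since `cos` is strictly decreasing on `[0, π]`, moving to a slightly later time enters `Y`; the
point is the limit as that time decreases to `z.1`. -/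
theorem mem_coneClosure {z : ℝ × E4} (h0 : 0 ≤ z.1) (hpi : z.1 < Real.pi) (hx : z.2 ≠ 0)
    (hle : Real.cos z.1 ≤ obstacleFun φ z.2) : z ∈ coneClosure K := by
  refine ⟨hx, ?_, ⟨h0, hpi⟩, mem_univ _⟩
  have hc : Continuous fun s : ℝ => (s, radialProj z.2) := by fun_prop
  have h1 : Tendsto (fun s : ℝ => (s, radialProj z.2)) (𝓝[>] z.1) (𝓝 (z.1, radialProj z.2)) :=
    (hc.tendsto z.1).mono_left nhdsWithin_le_nhds
  refine mem_closure_of_tendsto h1 ?_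
  filter_upwards [Ioo_mem_nhdsGT hpi] with s hs
  refine mem_exterior_of_mem_cone (z := (s, z.2)) hφ hK ⟨h0.trans hs.1.le, hs.2, hx, ?_⟩
  exact (Real.cos_lt_cos_of_nonneg_of_le_pi h0 hs.2.le hs.1).trans_le hle

theorem coneExterior_subset : coneExterior φ ⊆ coneClosure K := fun _ hz =>
  mem_coneClosure hφ hK hz.1 hz.2.1 hz.2.2.1 hz.2.2.2.le

theorem radialExt_eq_zero (hbdry : ∀ p ∈ exteriorBoundary K, u p = 0) {z : ℝ × E4} (h0 : 0 < z.1)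
    (hpi : z.1 < Real.pi) (hx : z.2 ≠ 0) (heq : Real.cos z.1 = obstacleFun φ z.2) :
    radialExt u z = 0 := by
  refine hbdry _ ⟨(mem_coneClosure hφ hK h0.le hpi hx heq.le).2, ?_⟩
  rw [mem_exterior_iff hφ hK h0.le hpi _ (Or.inl h0), obstacleFun_radialProj hx, heq]
  exact lt_irrefl _

include hφs

/-- The neighbourhood is one-sided in time so as to include time 0, where `timeDeriv` is a one-sided
derivative too. -/
theorem coneClosure_mem_nhdsWithin {z : ℝ × E4} (hz : z ∈ coneExterior φ) :
    coneClosure K ∈ 𝓝[Ici 0 ×ˢ univ] z := by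
  obtain ⟨h0, hpi, hx, hlt⟩ := hz
  have h1 : ∀ᶠ y : ℝ × E4 in 𝓝 z, y.1 < Real.pi :=
    continuous_fst.continuousAt.eventually_lt continuousAt_const hpi
  have h2 : ∀ᶠ y : ℝ × E4 in 𝓝 z, y.2 ≠ 0 :=
    continuous_snd.continuousAt.eventually_ne hx
  have h3 : ∀ᶠ y : ℝ × E4 in 𝓝 z, Real.cos y.1 < obstacleFun φ y.2 :=
    (Real.continuous_cos.comp continuous_fst).continuousAt.eventually_lt
      ((continuousAt_obstacleFun hφs hφ hx).comp continuous_snd.continuousAt) hlt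
  filter_upwards [nhdsWithin_le_nhds h1, nhdsWithin_le_nhds h2, nhdsWithin_le_nhds h3,
    self_mem_nhdsWithin] with y h1 h2 h3 h4
  exact coneExterior_subset hφ hK ⟨h4.1, h1, h2, h3⟩

theorem coneExterior_mem_nhds {z : ℝ × E4} (hz : z ∈ coneExterior φ) (h0 : 0 < z.1) :
    coneExterior φ ∈ 𝓝 z := by
  obtain ⟨-, hpi, hx, hlt⟩ := hz
  have h1 : ∀ᶠ y : ℝ × E4 in 𝓝 z, y.1 < Real.pi :=
    continuous_fst.continuousAt.eventually_lt continuousAt_const hpi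
  have h2 : ∀ᶠ y : ℝ × E4 in 𝓝 z, y.2 ≠ 0 :=
    continuous_snd.continuousAt.eventually_ne hx
  have h3 : ∀ᶠ y : ℝ × E4 in 𝓝 z, Real.cos y.1 < obstacleFun φ y.2 :=
    (Real.continuous_cos.comp continuous_fst).continuousAt.eventually_lt
      ((continuousAt_obstacleFun hφs hφ hx).comp continuous_snd.continuousAt) hlt
  have h4 : ∀ᶠ y : ℝ × E4 in 𝓝 z, 0 < y.1 :=
    continuousAt_const.eventually_lt continuous_fst.continuousAt h0
  filter_upwards [h1, h2, h3, h4] with y h1 h2 h3 h4 using ⟨h4.le, h1, h2, h3⟩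

theorem contDiffAt_radialExt
    (hu : ContMDiffOn (𝓘(ℝ, ℝ).prod (𝓡 3)) 𝓘(ℝ, ℝ) 2 u (exteriorClosure K))
    {z : ℝ × E4} (hz : z ∈ coneExterior φ) (h0 : 0 < z.1) : ContDiffAt ℝ 2 (radialExt u) z :=
  (contDiffOn_radialExt hu).contDiffAt
    (mem_of_superset (coneExterior_mem_nhds hφs hφ hK hz h0) (coneExterior_subset hφ hK))

end

theorem fderiv_radialExt_radial {z : ℝ × E4} (hd : DifferentiableAt ℝ (radialExt u) z) :
    fderiv ℝ (radialExt u) z (0, z.2) = 0 := by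
  have h1 : HasFDerivAt (fun x => radialExt u (z.1, x))
      ((fderiv ℝ (radialExt u) z).comp (ContinuousLinearMap.inr ℝ ℝ E4)) z.2 :=
    HasFDerivAt.comp (g := radialExt u) (f := fun x : E4 => (z.1, x)) z.2 hd.hasFDerivAt
      (hasFDerivAt_prodMk_right z.1 z.2)
  have h2 := fderiv_apply_self_of_homogeneous (f := fun x => radialExt u (z.1, x))
    (fun c hc x => by simp [radialExt, radialProj_smul hc]) h1.differentiableAt
  rw [h1.fderiv] at h2
  simpa using h2

section

variable (hφs : ContMDiff (𝓡 2) 𝓘(ℝ, ℝ) ∞ φ) (hφ : ∀ θ, 0 < φ θ)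
  (hK : K = {x | ∃ (r : ℝ) (θ : S2), 0 ≤ r ∧ r ≤ φ θ ∧ x = r • (θ : E3)})
  {ι : Type*} [Fintype ι] (b : OrthonormalBasis ι ℝ E4)

include hφs hφ hK

/-- Stated for any derivative `L` relative to the closed cone, so that it applies at `T = 0`; the
continuous choice of `L` then yields continuity of `|u'|` down to the initial time. -/
theorem normDeriv_sq_eq {T : ℝ} {X : S3} (hz : (T, (X : E4)) ∈ coneExterior φ)
    {L : ℝ × E4 →L[ℝ] ℝ} (hL : HasFDerivWithinAt (radialExt u) L (coneClosure K) (T, (X : E4))) :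
    normDeriv u (T, X) ^ 2 = L (1, 0) ^ 2 + ∑ i, L (0, b i) ^ 2 := by
  have hL' : HasFDerivWithinAt (radialExt u) L (Ici 0 ×ˢ univ) (T, (X : E4)) :=
    hL.mono_of_mem_nhdsWithin (coneClosure_mem_nhdsWithin hφs hφ hK hz)
  have h1 : timeDeriv u (T, X) = L (1, 0) := by
    have h2 : HasDerivWithinAt (fun S => u (S, X)) (L (1, 0)) (Ici 0) T := by
      have h3 := hL'.comp_hasDerivWithinAt (f := fun S : ℝ => (S, (X : E4))) (s := Ici 0) T
        ((hasDerivAt_id T).prodMk (hasDerivAt_const T (X : E4))).hasDerivWithinAt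
        (fun S hS => ⟨hS, mem_univ _⟩)
      refine h3.congr_of_mem (fun S _ => ?_) hz.1
      simp [radialExt, radialProj_coe]
    exact h2.derivWithin (uniqueDiffOn_Ici 0 T hz.1)
  have h4 : HasFDerivAt (fun x => u (T, radialProj x)) (L.comp (ContinuousLinearMap.inr ℝ ℝ E4))
      (X : E4) := by
    rw [← hasFDerivWithinAt_univ]
    exact hL'.comp (f := fun x : E4 => (T, x)) (s := univ) (X : E4)
      (hasFDerivAt_prodMk_right T (X : E4)).hasFDerivWithinAt (fun x _ => ⟨hz.1, mem_univ _⟩)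
  have h5 : ‖sphereGrad (fun X => u (T, X)) X‖ ^ 2 = ∑ i, L (0, b i) ^ 2 := by
    rw [← b.sum_sq_norm_inner_left]
    refine Finset.sum_congr rfl fun i _ => ?_
    rw [sphereGrad, gradient, InnerProductSpace.toDual_symm_apply, h4.fderiv]
    simp
  rw [normDeriv, Real.sq_sqrt (by positivity), h1]
  simp only [h5]

theorem normDeriv_sq_eq_energyDensity
    (hu : ContMDiffOn (𝓘(ℝ, ℝ).prod (𝓡 3)) 𝓘(ℝ, ℝ) 2 u (exteriorClosure K))
    {z : ℝ × E4} (hz : z ∈ coneExterior φ) (h0 : 0 < z.1) :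
    normDeriv u (z.1, radialProj z.2) ^ 2 = energyDensity b (radialExt u) z := by
  have hx := hz.2.2.1
  have hn := norm_pos_iff.2 hx
  have h1 : (z.1, (radialProj z.2 : E4)) = dilation ‖z.2‖⁻¹ (inv_pos.2 hn).ne' z := by
    rw [dilation_apply, coe_radialProj hx]
  have hz' : (z.1, (radialProj z.2 : E4)) ∈ coneExterior φ :=
    ⟨hz.1, hz.2.1, ne_zero_of_mem_unit_sphere _, by
      simpa only [obstacleFun_radialProj hx] using hz.2.2.2⟩
  rw [normDeriv_sq_eq hφs hφ hK b hz' ((contDiffAt_radialExt hφs hφ hK hu hz'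
    h0).differentiableAt (by norm_num)).hasFDerivAt.hasFDerivWithinAt,
    ← energyDensity_dilation (inv_pos.2 hn).ne' (radialExt_dilation (inv_pos.2 hn)) z, ← h1]
  simp [energyDensity, partialT, partialX]

/-- On the unit sphere the weight `|x|²` is 1, and what remains is to identify iterated partial
derivatives of the slices with those of the extension. -/
theorem waveOp_eq_of_sphere
    (hu : ContMDiffOn (𝓘(ℝ, ℝ).prod (𝓡 3)) 𝓘(ℝ, ℝ) 2 u (exteriorClosure K))
    {T : ℝ} {X : S3} (hz : (T, (X : E4)) ∈ coneExterior φ) (h0 : 0 < T) :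
    waveOp u (T, X) = conicalWaveOp b (radialExt u) (T, (X : E4)) := by
  have hC := contDiffAt_radialExt hφs hφ hK hu hz h0
  have hev : ∀ᶠ z in 𝓝 (T, (X : E4)), DifferentiableAt ℝ (radialExt u) z := by
    filter_upwards [hC.eventually (by simp)] with z hz using hz.differentiableAt (by norm_num)
  have h1 : timeDeriv2 u (T, X) = partialT (partialT (radialExt u)) (T, (X : E4)) := by
    have e1 : timeDeriv2 u (T, X) = iteratedDeriv 2 (fun S => radialExt u (S, (X : E4))) T := by
      rw [timeDeriv2, iteratedDerivWithin, iteratedDeriv]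
      have h2 : (Ici (0 : ℝ)) =ᶠ[𝓝 T] univ := eventuallyEq_univ.2 (Ici_mem_nhds h0)
      rw [iteratedFDerivWithin_congr_set h2, iteratedFDerivWithin_univ]
      simp [radialExt, radialProj_coe]
    rw [e1, iteratedDeriv_succ, iteratedDeriv_one]
    have e2 : deriv (fun S => radialExt u (S, (X : E4))) =ᶠ[𝓝 T]
        fun S => partialT (radialExt u) (S, (X : E4)) := by
      have hc : Tendsto (fun S : ℝ => (S, (X : E4))) (𝓝 T) (𝓝 (T, (X : E4))) :=
        Continuous.tendsto (by fun_prop) T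
      filter_upwards [hc.eventually hev] with S hS
      exact (hS.hasFDerivAt.comp_hasDerivAt (f := fun S : ℝ => (S, (X : E4))) S
        ((hasDerivAt_id S).prodMk (hasDerivAt_const S (X : E4)))).deriv
    rw [e2.deriv_eq]
    exact (((contDiffAt_partialT hC).differentiableAt
      (by norm_num)).hasFDerivAt.comp_hasDerivAt (f := fun S : ℝ => (S, (X : E4))) T
        ((hasDerivAt_id T).prodMk (hasDerivAt_const T (X : E4)))).deriv
  have h2 : sphereLaplacian (fun X => u (T, X)) X =
      ∑ i, partialX b (partialX b (radialExt u) i) i (T, (X : E4)) := by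
    change Laplacian.laplacian (fun x : E4 => radialExt u (T, x)) (X : E4) = _
    rw [InnerProductSpace.laplacian_eq_iteratedFDeriv_orthonormalBasis _ b]
    refine Finset.sum_congr rfl fun i _ => ?_
    rw [iteratedFDeriv_two_apply]
    have hc : Tendsto (fun x : E4 => (T, x)) (𝓝 (X : E4)) (𝓝 (T, (X : E4))) :=
      Continuous.tendsto (by fun_prop) _
    have e2 : fderiv ℝ (fun x => radialExt u (T, x)) =ᶠ[𝓝 (X : E4)]
        fun x => (fderiv ℝ (radialExt u) (T, x)).comp (ContinuousLinearMap.inr ℝ ℝ E4) := by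
      filter_upwards [hc.eventually hev] with x hx
      exact (hx.hasFDerivAt.comp x (hasFDerivAt_prodMk_right T x)).fderiv
    have hd : DifferentiableAt ℝ (fun x : E4 => fderiv ℝ (radialExt u) (T, x)) (X : E4) :=
      DifferentiableAt.comp (f := fun x : E4 => (T, x)) (X : E4)
        ((hC.fderiv_right (m := 1) (by norm_num)).differentiableAt (by norm_num))
        (by fun_prop)
    have e3 : HasFDerivAt (fun x : E4 => partialX b (radialExt u) i (T, x))
        ((fderiv ℝ (partialX b (radialExt u) i) (T, (X : E4))).comp
          (ContinuousLinearMap.inr ℝ ℝ E4)) (X : E4) :=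
      ((contDiffAt_partialX hC i).differentiableAt (by norm_num)).hasFDerivAt.comp (X : E4)
        (hasFDerivAt_prodMk_right T (X : E4))
    have e4 : HasFDerivAt (fun x : E4 => partialX b (radialExt u) i (T, x)) _ (X : E4) :=
      hd.hasFDerivAt.clm_apply (hasFDerivAt_const ((0 : ℝ), b i) (X : E4))
    have e5 := congrArg (fun L : E4 →L[ℝ] ℝ => L (b i)) (e4.unique e3)
    have e6 : HasFDerivAt (fun x => (fderiv ℝ (radialExt u) (T, x)).comp
        (ContinuousLinearMap.inr ℝ ℝ E4)) _ (X : E4) :=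
      hd.hasFDerivAt.clm_comp (hasFDerivAt_const (ContinuousLinearMap.inr ℝ ℝ E4) (X : E4))
    rw [e2.fderiv_eq, e6.fderiv]
    simp at e5 ⊢
    exact e5
  rw [waveOp, h1, conicalWaveOp]
  simp only [h2]
  simp

theorem waveOp_eq_conicalWaveOp
    (hu : ContMDiffOn (𝓘(ℝ, ℝ).prod (𝓡 3)) 𝓘(ℝ, ℝ) 2 u (exteriorClosure K))
    {z : ℝ × E4} (hz : z ∈ coneExterior φ) (h0 : 0 < z.1) :
    waveOp u (z.1, radialProj z.2) = conicalWaveOp b (radialExt u) z := by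
  have hx := hz.2.2.1
  have hn := norm_pos_iff.2 hx
  have h1 : (z.1, (radialProj z.2 : E4)) = dilation ‖z.2‖⁻¹ (inv_pos.2 hn).ne' z := by
    rw [dilation_apply, coe_radialProj hx]
  have hz' : (z.1, (radialProj z.2 : E4)) ∈ coneExterior φ :=
    ⟨hz.1, hz.2.1, ne_zero_of_mem_unit_sphere _, by
      simpa only [obstacleFun_radialProj hx] using hz.2.2.2⟩
  rw [waveOp_eq_of_sphere hφs hφ hK b hu hz' h0,
    ← conicalWaveOp_dilation (inv_pos.2 hn).ne' (radialExt_dilation (inv_pos.2 hn)) z, ← h1]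

end

end Pullback

/-! ### The sign of the flux at the moving boundary. -/

section BoundaryFlux

variable {ι : Type*} [Fintype ι] (b : OrthonormalBasis ι ℝ E4)

/-- The energy flux through the level sets of `γ - cos T`, of a function with derivative `L z`
at `z`. -/
def levelFlux (γ : E4 → ℝ) (L : ℝ × E4 → ℝ × E4 →L[ℝ] ℝ) (z : ℝ × E4) : ℝ :=
  Real.sin z.1 * (L z (1, 0) ^ 2 + ‖z.2‖ ^ 2 * ∑ i, L z (0, b i) ^ 2)
    - 2 * ‖z.2‖ ^ 2 * L z (1, 0) * ∑ i, L z (0, b i) * fderiv ℝ γ z.2 (b i)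

variable {u : ℝ × S3 → ℝ} {K : Set E3} {φ : S2 → ℝ}

/-- This is where `C²` regularity up to the boundary is used: the differential has a continuous
extension `L`. At boundary points `fderiv` carries no information, which is why `levelFlux` takes
the differential as an argument. -/
theorem exists_hasFDerivWithinAt
    (hu : ContMDiffOn (𝓘(ℝ, ℝ).prod (𝓡 3)) 𝓘(ℝ, ℝ) 2 u (exteriorClosure K))
    {p : ℝ × E4} (hp : p ∈ coneClosure K) :
    ∃ L : ℝ × E4 → ℝ × E4 →L[ℝ] ℝ, ContinuousWithinAt L (coneClosure K) p ∧
      ∀ᶠ z in 𝓝[coneClosure K] p, HasFDerivWithinAt (radialExt u) (L z) (coneClosure K) z := by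
  have h1 : ContDiffWithinAt ℝ (1 + 1) (radialExt u) (coneClosure K) p := by
    have := contDiffOn_radialExt hu p hp
    rwa [one_add_one_eq_two]
  rw [contDiffWithinAt_succ_iff_hasFDerivWithinAt' (by simp)] at h1
  obtain ⟨U, hU, -, -, L, hL, hLc⟩ := h1
  rw [insert_eq_of_mem hp] at hU
  refine ⟨L, hLc.continuousWithinAt, ?_⟩
  filter_upwards [hU] with z hz using hL z hz

variable (hφs : ContMDiff (𝓡 2) 𝓘(ℝ, ℝ) ∞ φ) (hφ : ∀ θ, 0 < φ θ)
  (hK : K = {x | ∃ (r : ℝ) (θ : S2), 0 ≤ r ∧ r ≤ φ θ ∧ x = r • (θ : E3)})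
include hφs hφ hK

/-- Near `p` the boundary is the graph `T = arccos γ(x)`. Differentiating `u = 0` along it gives `∇v
= a ∇γ` and `∂_T v = a sin T`, so the flux is `a² sin T (sin² T - |x|²|∇γ|²)`, with sign given by
`one_sub_sq_le_gradient`. -/
theorem levelFlux_boundary_nonpos (hbdry : ∀ p ∈ exteriorBoundary K, u p = 0) {p : ℝ × E4}
    (h0 : 0 < p.1) (hpi : p.1 < Real.pi) (hx : p.2 ≠ 0)
    (heq : Real.cos p.1 = obstacleFun φ p.2) {L : ℝ × E4 → ℝ × E4 →L[ℝ] ℝ}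
    (hL : HasFDerivWithinAt (radialExt u) (L p) (coneClosure K) p) :
    levelFlux b (obstacleFun φ) L p ≤ 0 := by
  have hs : 0 < Real.sin p.1 := Real.sin_pos_of_pos_of_lt_pi h0 hpi
  have hsc := Real.sin_sq_add_cos_sq p.1
  have hγ : obstacleFun φ p.2 ^ 2 ≠ 1 := by
    rw [← heq]; nlinarith
  have hx' := spatial_ne_zero_of_sq_ne_one hx hγ
  have hd := ((contDiffAt_obstacleFun hφs hφ hx hx').differentiableAt (by norm_num)).hasFDerivAt
  have hgrad := one_sub_sq_le_gradient hφs hφ hx hx' b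
  set s := Real.sin p.1
  have hτ : Real.arccos (obstacleFun φ p.2) = p.1 := by
    rw [← heq, Real.arccos_cos h0.le hpi.le]
  have hsqrt : √(1 - obstacleFun φ p.2 ^ 2) = s := by
    rw [← heq, show 1 - Real.cos p.1 ^ 2 = s ^ 2 by linarith, Real.sqrt_sq hs.le]
  have harc : HasFDerivAt (fun x => Real.arccos (obstacleFun φ x))
      (-(1 / s) • fderiv ℝ (obstacleFun φ) p.2) p.2 := by
    have h1 := Real.hasDerivAt_arccos (x := obstacleFun φ p.2)
      (fun h => hγ (by rw [h]; norm_num)) (fun h => hγ (by rw [h]; norm_num))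
    rw [hsqrt] at h1
    exact h1.comp_hasFDerivAt p.2 hd
  have hcurve : HasFDerivAt (fun x => (Real.arccos (obstacleFun φ x), x))
      ((-(1 / s) • fderiv ℝ (obstacleFun φ) p.2).prod (ContinuousLinearMap.id ℝ E4)) p.2 :=
    harc.prodMk (hasFDerivAt_id p.2)
  have hp : (Real.arccos (obstacleFun φ p.2), p.2) = p := by rw [hτ]
  set A : Set E4 := {x | x ≠ 0 ∧ 0 < Real.arccos (obstacleFun φ x) ∧
    Real.arccos (obstacleFun φ x) < Real.pi ∧
    Real.cos (Real.arccos (obstacleFun φ x)) = obstacleFun φ x} with hA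
  have hAn : A ∈ 𝓝 p.2 := by
    have h1 := hd.continuousAt
    have h2 := harc.continuousAt
    have h3 : obstacleFun φ p.2 < 1 := by rw [← heq]; nlinarith
    have h4 : -1 < obstacleFun φ p.2 := by rw [← heq]; nlinarith
    filter_upwards [isOpen_ne.mem_nhds hx, h1.eventually_lt_const h3, h1.eventually_const_lt h4,
      h2.eventually_const_lt (h0.trans_eq hτ.symm), h2.eventually_lt_const (hτ.trans_lt hpi)]
      with x hx h1 h2 h3 h4 using ⟨hx, h3, h4, Real.cos_arccos h2.le h1.le⟩
  -- Although `L p` is a derivative only relative to the closed cone, the graph stays inside the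
  -- cone, so the composite is differentiable in the full sense.
  have hcomp : HasFDerivAt (fun x => radialExt u (Real.arccos (obstacleFun φ x), x))
      ((L p).comp ((-(1 / s) • fderiv ℝ (obstacleFun φ) p.2).prod (ContinuousLinearMap.id ℝ E4)))
      p.2 := by
    rw [← hp] at hL
    have h1 := hL.comp (f := fun x => (Real.arccos (obstacleFun φ x), x)) (s := A) p.2
      hcurve.hasFDerivWithinAt (fun x hx =>
        mem_coneClosure hφ hK hx.2.1.le hx.2.2.1 hx.1 hx.2.2.2.le)
    rw [hp] at h1
    exact h1.hasFDerivAt hAn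
  have hzero : (L p).comp ((-(1 / s) • fderiv ℝ (obstacleFun φ) p.2).prod
      (ContinuousLinearMap.id ℝ E4)) = 0 := by
    refine hcomp.unique ((hasFDerivAt_const (0 : ℝ) p.2).congr_of_eventuallyEq ?_)
    filter_upwards [hAn] with x hx
    exact radialExt_eq_zero hφ hK hbdry hx.2.1 hx.2.2.1 hx.1 hx.2.2.2
  have hLy : ∀ y : E4, L p (0, y) = L p (1, 0) / s * fderiv ℝ (obstacleFun φ) p.2 y := by
    intro y
    have h1 := congrArg (fun M : E4 →L[ℝ] ℝ => M y) hzero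
    simp only [ContinuousLinearMap.comp_apply, ContinuousLinearMap.prod_apply,
      smul_apply, ContinuousLinearMap.id_apply,
      zero_apply, smul_eq_mul] at h1
    have h2 : ∀ c : ℝ, (c, y) = c • ((1 : ℝ), (0 : E4)) + (0, y) := fun c => by simp
    rw [h2, map_add, map_smul, smul_eq_mul] at h1
    linear_combination h1
  rw [levelFlux]
  simp only [hLy]
  set a := L p (1, 0) / s with ha
  have hLa : L p (1, 0) = a * s := by rw [ha]; field_simp
  rw [hLa]
  have e1 : ∑ i, (a * fderiv ℝ (obstacleFun φ) p.2 (b i)) ^ 2 =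
      a ^ 2 * ∑ i, fderiv ℝ (obstacleFun φ) p.2 (b i) ^ 2 := by
    rw [Finset.mul_sum]; exact Finset.sum_congr rfl fun i _ => by ring
  have e2 : ∑ i, a * fderiv ℝ (obstacleFun φ) p.2 (b i) * fderiv ℝ (obstacleFun φ) p.2 (b i) =
      a * ∑ i, fderiv ℝ (obstacleFun φ) p.2 (b i) ^ 2 := by
    rw [Finset.mul_sum]; exact Finset.sum_congr rfl fun i _ => by ring
  rw [e1, e2]
  rw [← heq] at hgrad
  set G := ∑ i, fderiv ℝ (obstacleFun φ) p.2 (b i) ^ 2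
  have h3 : 0 ≤ a ^ 2 * s * (‖p.2‖ ^ 2 * G - s ^ 2) :=
    mul_nonneg (by positivity) (by linarith)
  linarith

/-- At the boundary the flux is at most 0 while `d sin T` is positive, so the strict inequality
persists nearby by continuity of `L`; inside `Y` the map `L` is the actual derivative. -/
theorem eventually_levelFlux_lt
    (hu : ContMDiffOn (𝓘(ℝ, ℝ).prod (𝓡 3)) 𝓘(ℝ, ℝ) 2 u (exteriorClosure K))
    (hbdry : ∀ p ∈ exteriorBoundary K, u p = 0) {p : ℝ × E4}
    (h0 : 0 < p.1) (hpi : p.1 < Real.pi) (hx : p.2 ≠ 0)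
    (heq : Real.cos p.1 = obstacleFun φ p.2) {d : ℝ} (hd : 0 < d) :
    ∀ᶠ z in 𝓝 p, Real.cos z.1 < obstacleFun φ z.2 →
      levelFlux b (obstacleFun φ) (fderiv ℝ (radialExt u)) z < d * Real.sin z.1 := by
  have hs : 0 < Real.sin p.1 := Real.sin_pos_of_pos_of_lt_pi h0 hpi
  have hp := mem_coneClosure hφ hK h0.le hpi hx heq.le
  obtain ⟨L, hLc, hL⟩ := exists_hasFDerivWithinAt hu hp
  have hγ : obstacleFun φ p.2 ^ 2 ≠ 1 := by
    rw [← heq]; nlinarith [Real.sin_sq_add_cos_sq p.1]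
  have hx' := spatial_ne_zero_of_sq_ne_one hx hγ
  have hγc : ContinuousWithinAt (fun z : ℝ × E4 => fderiv ℝ (obstacleFun φ) z.2)
      (coneClosure K) p := by
    have h1 := ((contDiffAt_obstacleFun hφs hφ hx hx').fderiv_right (m := 0)
      (by norm_num)).continuousAt
    exact (ContinuousAt.comp (f := fun z : ℝ × E4 => z.2) h1
      continuous_snd.continuousAt).continuousWithinAt
  have hG : ContinuousWithinAt (levelFlux b (obstacleFun φ) L) (coneClosure K) p := by
    have hc := fun y : ℝ × E4 => hLc.clm_apply (continuousWithinAt_const (b := y))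
    have hg := fun y : E4 => hγc.clm_apply (continuousWithinAt_const (b := y))
    have hn : ContinuousWithinAt (fun z : ℝ × E4 => ‖z.2‖ ^ 2) (coneClosure K) p := by fun_prop
    have hsin : ContinuousWithinAt (fun z : ℝ × E4 => Real.sin z.1) (coneClosure K) p := by fun_prop
    refine (hsin.mul (((hc _).pow 2).add (hn.mul ?_))).sub
      (((continuousWithinAt_const.mul hn).mul (hc _)).mul ?_)
    · exact tendsto_finsetSum _ fun i _ => (hc _).pow 2
    · exact tendsto_finsetSum _ fun i _ => (hc _).mul (hg _)
  have hlt : ∀ᶠ z in 𝓝[coneClosure K] p, levelFlux b (obstacleFun φ) L z < d * Real.sin z.1 := by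
    have hsin : ContinuousWithinAt (fun z : ℝ × E4 => d * Real.sin z.1) (coneClosure K) p := by
      fun_prop
    refine hG.eventually_lt hsin ?_
    exact (levelFlux_boundary_nonpos b hφs hφ hK hbdry h0 hpi hx heq
      (hL.self_of_nhdsWithin hp)).trans_lt (by positivity)
  rw [eventually_nhdsWithin_iff] at hlt hL
  have h1 : ∀ᶠ y : ℝ × E4 in 𝓝 p, y.1 < Real.pi :=
    continuous_fst.continuousAt.eventually_lt continuousAt_const hpi
  have h2 : ∀ᶠ y : ℝ × E4 in 𝓝 p, y.2 ≠ 0 :=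
    continuous_snd.continuousAt.eventually_ne hx
  have h3 : ∀ᶠ y : ℝ × E4 in 𝓝 p, 0 < y.1 :=
    continuousAt_const.eventually_lt continuous_fst.continuousAt h0
  filter_upwards [hlt, hL, h1, h2, h3] with z hz hLz h1 h2 h3 h4
  have hzW : z ∈ coneExterior φ := ⟨h3.le, h1, h2, h4⟩
  have hzD := coneExterior_subset hφ hK hzW
  have h5 : fderiv ℝ (radialExt u) z = L z :=
    ((hLz hzD).hasFDerivAt (mem_of_superset (coneExterior_mem_nhds hφs hφ hK hzW h3)
      (coneExterior_subset hφ hK))).fderiv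
  have h6 := hz hzD
  rw [levelFlux] at h6 ⊢
  rwa [h5]

theorem eventually_forall_levelFlux_le
    (hu : ContMDiffOn (𝓘(ℝ, ℝ).prod (𝓡 3)) 𝓘(ℝ, ℝ) 2 u (exteriorClosure K))
    (hbdry : ∀ p ∈ exteriorBoundary K, u p = 0) {t₁ t₂ : ℝ} (ht₁ : 0 < t₁) (ht₂ : t₂ < Real.pi)
    {d : ℝ} (hd : 0 < d) :
    ∀ᶠ ε in 𝓝 (0 : ℝ), ∀ z ∈ Icc t₁ t₂ ×ˢ {x : E4 | 1 / 2 ≤ ‖x‖ ^ 2 ∧ ‖x‖ ^ 2 ≤ 3 / 2},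
      Real.cos z.1 < obstacleFun φ z.2 → obstacleFun φ z.2 - Real.cos z.1 ≤ 2 * ε →
      levelFlux b (obstacleFun φ) (fderiv ℝ (radialExt u)) z ≤ d * Real.sin z.1 := by
  have hcomp : IsCompact {x : E4 | 1 / 2 ≤ ‖x‖ ^ 2 ∧ ‖x‖ ^ 2 ≤ 3 / 2} := by
    refine (isCompact_closedBall (0 : E4) 2).of_isClosed_subset ?_ fun x hx => ?_
    · exact (isClosed_le continuous_const (continuous_norm.pow 2)).inter
        (isClosed_le (continuous_norm.pow 2) continuous_const)
    · rw [mem_closedBall_zero_iff]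
      have := hx.2
      nlinarith [norm_nonneg x]
  refine (isCompact_Icc.prod hcomp).eventually_forall_of_forall_eventually fun p hp => ?_
  have hx : p.2 ≠ 0 := by
    intro h
    have := hp.2.1
    rw [h, norm_zero] at this
    norm_num at this
  have hw : ContinuousAt (fun z : ℝ × E4 => obstacleFun φ z.2 - Real.cos z.1) p :=
    ((continuousAt_obstacleFun hφs hφ hx).comp continuous_snd.continuousAt).sub
      (Real.continuous_cos.comp continuous_fst).continuousAt
  have hsnd : Tendsto (fun y : ℝ × (ℝ × E4) => y.2) (𝓝 (0, p)) (𝓝 p) := continuous_snd.tendsto _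
  -- Near points inside the obstacle the first condition fails, near points of `Y` the condition
  -- with `2 ε` fails for small `ε`, and only boundary points need an estimate.
  rcases lt_trichotomy (obstacleFun φ p.2 - Real.cos p.1) 0 with h | h | h
  · filter_upwards [hsnd.eventually (hw.eventually_lt_const h)] with y hy h1
    linarith
  · have h1 := eventually_levelFlux_lt b hφs hφ hK hu hbdry (p := p) (ht₁.trans_le hp.1.1)
      (hp.1.2.trans_lt ht₂) hx (by linarith) hd
    filter_upwards [hsnd.eventually h1] with y hy h1 _ using (hy h1).le
  · have h1 : ContinuousAt (fun y : ℝ × (ℝ × E4) => 2 * y.1) (0, p) := by fun_prop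
    have h2 : ContinuousAt (fun y : ℝ × (ℝ × E4) => obstacleFun φ y.2.2 - Real.cos y.2.1) (0, p) :=
      ContinuousAt.comp (g := fun z : ℝ × E4 => obstacleFun φ z.2 - Real.cos z.1)
        (f := fun y : ℝ × (ℝ × E4) => y.2) (x := (0, p)) hw continuous_snd.continuousAt
    filter_upwards [h1.eventually_lt h2 (by simpa using h)] with y hy _ h3
    linarith

end BoundaryFlux

/-! ### The concrete cutoff functions and their flux. -/

section Cutoff

/-- The cutoff function which vanishes for `γ - cos T ≤ ε`. -/
def levelCutoff (γ : E4 → ℝ) (ε : ℝ) (z : ℝ × E4) : ℝ :=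
  annulusBump z.2 * Real.smoothTransition ((γ z.2 - Real.cos z.1) / ε - 1)

variable {φ : S2 → ℝ}

theorem hasFDerivAt_annulusBump (x : E4) :
    ∃ c : ℝ, HasFDerivAt annulusBump (c • innerSL ℝ x) x := by
  set f : ContDiffBump (1 : ℝ) := ⟨1 / 4, 1 / 2, by norm_num, by norm_num⟩
  have h1 : HasDerivAt f (deriv f (‖x‖ ^ 2)) (‖x‖ ^ 2) :=
    ((f.contDiff (n := 1)).differentiable (by norm_num) _).hasDerivAt
  have h2 := h1.comp_hasFDerivAt x (hasStrictFDerivAt_norm_sq x).hasFDerivAt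
  refine ⟨deriv f (‖x‖ ^ 2) * 2, h2.congr_fderiv ?_⟩
  ext y
  simp [mul_assoc]

theorem deriv_smoothTransition_nonneg (s : ℝ) : 0 ≤ deriv Real.smoothTransition s :=
  Real.smoothTransition.monotone.deriv_nonneg

theorem mem_Icc_of_deriv_smoothTransition_ne_zero {s : ℝ}
    (h : deriv Real.smoothTransition s ≠ 0) : s ∈ Icc (0 : ℝ) 1 := by
  constructor
  · by_contra! hs
    have : Real.smoothTransition =ᶠ[𝓝 s] fun _ => 0 := by
      filter_upwards [Iio_mem_nhds hs] with y hy
      exact Real.smoothTransition.zero_of_nonpos (le_of_lt hy)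
    exact h (by rw [this.deriv_eq]; simp)
  · by_contra! hs
    have : Real.smoothTransition =ᶠ[𝓝 s] fun _ => 1 := by
      filter_upwards [Ioi_mem_nhds hs] with y hy
      exact Real.smoothTransition.one_of_one_le (le_of_lt hy)
    exact h (by rw [this.deriv_eq]; simp)

variable (hφs : ContMDiff (𝓡 2) 𝓘(ℝ, ℝ) ∞ φ) (hφ : ∀ θ, 0 < φ θ)

theorem levelCutoff_eventuallyEq_zero_of_norm {γ : E4 → ℝ} {ε : ℝ} {z : ℝ × E4}
    (hz : ‖z.2‖ ^ 2 < 1 / 2) : levelCutoff γ ε =ᶠ[𝓝 z] fun _ => 0 := by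
  have h1 : ContinuousAt (fun y : ℝ × E4 => ‖y.2‖ ^ 2) z := by fun_prop
  filter_upwards [h1.eventually_lt_const hz] with y hy
  rw [levelCutoff, annulusBump_eq_zero (Or.inl hy.le), zero_mul]

include hφs hφ

theorem continuousAt_level {z : ℝ × E4} (hx : z.2 ≠ 0) :
    ContinuousAt (fun y : ℝ × E4 => obstacleFun φ y.2 - Real.cos y.1) z :=
  ((continuousAt_obstacleFun hφs hφ hx).comp continuous_snd.continuousAt).sub
      (Real.continuous_cos.comp continuous_fst).continuousAt

theorem levelCutoff_eventuallyEq_zero {ε : ℝ} (hε : 0 < ε) {z : ℝ × E4} (hx : z.2 ≠ 0)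
    (hz : obstacleFun φ z.2 - Real.cos z.1 < ε) :
    levelCutoff (obstacleFun φ) ε =ᶠ[𝓝 z] fun _ => 0 := by
  filter_upwards [(continuousAt_level hφs hφ hx).eventually_lt_const hz] with y hy
  rw [levelCutoff, Real.smoothTransition.zero_of_nonpos, mul_zero]
  have := (div_lt_one hε).2 hy
  linarith

theorem levelCutoff_eventuallyEq_bump {ε : ℝ} (hε : 0 < ε) {z : ℝ × E4} (hx : z.2 ≠ 0)
    (hz : 2 * ε < obstacleFun φ z.2 - Real.cos z.1) :
    levelCutoff (obstacleFun φ) ε =ᶠ[𝓝 z] fun y => annulusBump y.2 := by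
  filter_upwards [(continuousAt_level hφs hφ hx).eventually_const_lt hz] with y hy
  rw [levelCutoff, Real.smoothTransition.one_of_one_le, mul_one]
  have := (le_div_iff₀ hε).2 hy.le
  linarith

/-- The differential splits into a radial part, from the bump, and a nonnegative multiple `m` of
`d(γ - cos T)`, which lives only in the transition layer. Where `γ` may fail to be differentiable,
`m = 0` and the derivative of `γ` in the formula is irrelevant. -/
theorem levelCutoff_local {t₁ t₂ ε : ℝ} (ht₁ : 0 < t₁) (ht₂ : t₂ < Real.pi) (hε : 0 < ε)
    (hε' : 2 * ε < 1 - Real.cos t₁) (z : ℝ × E4) (hz : z.1 ∈ Ioo t₁ t₂) :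
    ContDiffAt ℝ 1 (levelCutoff (obstacleFun φ) ε) z ∧
    ∃ c m : ℝ, 0 ≤ m ∧ (m ≠ 0 → (1 / 2 ≤ ‖z.2‖ ^ 2 ∧ ‖z.2‖ ^ 2 ≤ 3 / 2) ∧
        Real.cos z.1 < obstacleFun φ z.2 ∧ obstacleFun φ z.2 - Real.cos z.1 ≤ 2 * ε) ∧
      ∀ y : ℝ × E4, fderiv ℝ (levelCutoff (obstacleFun φ) ε) z y =
        c * inner ℝ z.2 y.2 + m * (Real.sin z.1 * y.1 + fderiv ℝ (obstacleFun φ) z.2 y.2) := by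
  have hzero : levelCutoff (obstacleFun φ) ε =ᶠ[𝓝 z] (fun _ => 0) → _ := fun h =>
    (⟨contDiffAt_const.congr_of_eventuallyEq h, 0, 0, le_rfl, by simp, fun y => by
      rw [h.fderiv_eq]; simp⟩ : ContDiffAt ℝ 1 (levelCutoff (obstacleFun φ) ε) z ∧
    ∃ c m : ℝ, 0 ≤ m ∧ (m ≠ 0 → (1 / 2 ≤ ‖z.2‖ ^ 2 ∧ ‖z.2‖ ^ 2 ≤ 3 / 2) ∧
        Real.cos z.1 < obstacleFun φ z.2 ∧ obstacleFun φ z.2 - Real.cos z.1 ≤ 2 * ε) ∧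
      ∀ y : ℝ × E4, fderiv ℝ (levelCutoff (obstacleFun φ) ε) z y =
        c * inner ℝ z.2 y.2 + m * (Real.sin z.1 * y.1 + fderiv ℝ (obstacleFun φ) z.2 y.2))
  have hz0 : 0 < z.1 := ht₁.trans hz.1
  have hzpi : z.1 < Real.pi := hz.2.trans ht₂
  by_cases hn : ‖z.2‖ ^ 2 < 1 / 2
  · exact hzero (levelCutoff_eventuallyEq_zero_of_norm hn)
  have hx : z.2 ≠ 0 := by rintro h; rw [h] at hn; norm_num at hn
  obtain ⟨c, hc⟩ := hasFDerivAt_annulusBump z.2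
  have hcz : HasFDerivAt (fun y : ℝ × E4 => annulusBump y.2)
      ((c • innerSL ℝ z.2).comp (ContinuousLinearMap.snd ℝ ℝ E4)) z :=
    hc.comp z hasFDerivAt_snd
  have hηs : ContDiffAt ℝ 1 (fun y : ℝ × E4 => annulusBump y.2) z :=
    (contDiff_annulusBump.comp contDiff_snd).contDiffAt
  -- The smallness of `ε` relative to `1 - cos t₁` puts points with `γ = 1` beyond the layer, where
  -- the cutoff is the bump; points with `γ = -1` are inside the obstacle.
  by_cases hγ : obstacleFun φ z.2 ^ 2 = 1
  · have hcos : Real.cos z.1 < Real.cos t₁ :=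
      Real.cos_lt_cos_of_nonneg_of_le_pi ht₁.le hzpi.le hz.1
    have hcos' : -1 < Real.cos z.1 := by
      rw [← Real.cos_pi]
      exact Real.cos_lt_cos_of_nonneg_of_le_pi hz0.le le_rfl hzpi
    rcases (show _ ∨ _ from by simpa using hγ) with h | h
    · have he := levelCutoff_eventuallyEq_bump hφs hφ hε hx (by rw [h]; linarith)
      refine ⟨hηs.congr_of_eventuallyEq he, c, 0, le_rfl, by simp, fun y => ?_⟩
      rw [he.fderiv_eq, hcz.fderiv]
      simp
    · exact hzero (levelCutoff_eventuallyEq_zero hφs hφ hε hx (by rw [h]; linarith))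
  · have hx' := spatial_ne_zero_of_sq_ne_one hx hγ
    have hγs := contDiffAt_obstacleFun hφs hφ hx hx'
    set s := (obstacleFun φ z.2 - Real.cos z.1) / ε - 1 with hs
    have hγd : HasFDerivAt (fun y : ℝ × E4 => obstacleFun φ y.2)
        ((fderiv ℝ (obstacleFun φ) z.2).comp (ContinuousLinearMap.snd ℝ ℝ E4)) z :=
      (hγs.differentiableAt (by norm_num)).hasFDerivAt.comp z hasFDerivAt_snd
    have hcosd : HasFDerivAt (fun y : ℝ × E4 => Real.cos y.1)
        ((-Real.sin z.1) • ContinuousLinearMap.fst ℝ ℝ E4) z :=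
      (Real.hasDerivAt_cos z.1).comp_hasFDerivAt z hasFDerivAt_fst
    have hin : HasFDerivAt (fun y : ℝ × E4 => (obstacleFun φ y.2 - Real.cos y.1) * ε⁻¹ - 1) _ z :=
      ((hγd.sub hcosd).mul_const ε⁻¹).sub_const 1
    have hst : HasDerivAt Real.smoothTransition (deriv Real.smoothTransition s)
        ((obstacleFun φ z.2 - Real.cos z.1) * ε⁻¹ - 1) := by
      rw [← div_eq_mul_inv, ← hs]
      exact ((Real.smoothTransition.contDiffAt (n := 1)).differentiableAt (by norm_num)).hasDerivAt
    have htot := hcz.fun_mul (hst.comp_hasFDerivAt z hin)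
    refine ⟨?_, Real.smoothTransition s * c,
      annulusBump z.2 * (deriv Real.smoothTransition s / ε), ?_, ?_, fun y => ?_⟩
    · refine hηs.mul (Real.smoothTransition.contDiffAt.comp z ?_)
      refine ContDiffAt.sub (ContDiffAt.div_const (ContDiffAt.sub ?_ ?_) _) contDiffAt_const
      · exact hγs.comp z contDiffAt_snd
      · exact Real.contDiff_cos.contDiffAt.comp z contDiffAt_fst
    · exact mul_nonneg (annulusBump_nonneg _)
        (div_nonneg (deriv_smoothTransition_nonneg _) hε.le)
    · intro hm
      have h1 : annulusBump z.2 ≠ 0 := left_ne_zero_of_mul hm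
      have h2 : deriv Real.smoothTransition s ≠ 0 := fun h => hm (by rw [h]; simp)
      have h3 := mem_Icc_of_deriv_smoothTransition_ne_zero h2
      refine ⟨⟨not_lt.1 hn, ?_⟩, ?_, ?_⟩
      · by_contra! h
        exact h1 (annulusBump_eq_zero (Or.inr h.le))
      · have h4 : 1 ≤ (obstacleFun φ z.2 - Real.cos z.1) / ε := by linarith [h3.1]
        rw [le_div_iff₀ hε] at h4
        linarith
      · have h4 : (obstacleFun φ z.2 - Real.cos z.1) / ε ≤ 2 := by linarith [h3.2]
        rw [div_le_iff₀ hε] at h4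
        linarith
    · have he : levelCutoff (obstacleFun φ) ε = fun y => annulusBump y.2 *
          (Real.smoothTransition ∘ fun y : ℝ × E4 =>
            (obstacleFun φ y.2 - Real.cos y.1) * ε⁻¹ - 1) y := by
        funext y
        rw [levelCutoff, Function.comp_apply, div_eq_mul_inv]
      rw [he, htot.fderiv]
      simp only [Function.comp_apply, ← div_eq_mul_inv, ← hs]
      simp
      field_simp
      ring

theorem isCutoff_levelCutoff {t₁ t₂ ε : ℝ} (ht₁ : 0 < t₁) (ht₂ : t₂ < Real.pi) (hε : 0 < ε)
    (hε' : 2 * ε < 1 - Real.cos t₁) :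
    IsCutoff (levelCutoff (obstacleFun φ) ε) (Ioo t₁ t₂) (coneExterior φ ∩ {z | 0 < z.1}) 2 where
  isOpen := isOpen_Ioo
  contDiffAt z hz := (levelCutoff_local hφs hφ ht₁ ht₂ hε hε' z hz).1
  eventually_eq_zero z hz hzW := by
    by_cases hx : z.2 = 0
    · exact levelCutoff_eventuallyEq_zero_of_norm (by rw [hx]; norm_num)
    · refine levelCutoff_eventuallyEq_zero hφs hφ hε hx ?_
      have h0 : 0 < z.1 := ht₁.trans hz.1
      by_contra! h
      exact hzW ⟨⟨h0.le, hz.2.trans ht₂, hx, by linarith⟩, h0⟩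
  eq_zero z _ hz := by
    rw [levelCutoff, annulusBump_eq_zero (Or.inr (by nlinarith)), zero_mul]
  nonneg z _ := mul_nonneg (annulusBump_nonneg _) (Real.smoothTransition.nonneg _)
  partialT_nonneg z hz := by
    obtain ⟨-, c, m, hm, -, h⟩ := levelCutoff_local hφs hφ ht₁ ht₂ hε hε' z hz
    rw [partialT, h]
    have := Real.sin_nonneg_of_nonneg_of_le_pi (ht₁.trans hz.1).le (hz.2.trans ht₂).le
    simpa using mul_nonneg hm this

variable {u : ℝ × S3 → ℝ} {K : Set E3} {ι : Type*} [Fintype ι] (b : OrthonormalBasis ι ℝ E4)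
  (hK : K = {x | ∃ (r : ℝ) (θ : S2), 0 ≤ r ∧ r ≤ φ θ ∧ x = r • (θ : E3)})

include hK

/-- The radial part of `dκ` pairs to zero with `∇v`, so the flux is `m` times `levelFlux`, while
`∂_T κ = m sin T`. The bound for `levelFlux` is needed only where `m ≠ 0`, that is, in the layer. -/
theorem eventually_flux_levelCutoff_le
    (hu : ContMDiffOn (𝓘(ℝ, ℝ).prod (𝓡 3)) 𝓘(ℝ, ℝ) 2 u (exteriorClosure K))
    (hbdry : ∀ p ∈ exteriorBoundary K, u p = 0) {t₁ t₂ : ℝ} (ht₁ : 0 < t₁) (ht₂ : t₂ < Real.pi)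
    {d : ℝ} (hd : 0 < d) :
    ∀ᶠ ε in 𝓝[>] (0 : ℝ), ∀ z ∈ coneExterior φ ∩ {z | 0 < z.1}, z.1 ∈ Ioo t₁ t₂ →
      flux b (levelCutoff (obstacleFun φ) ε) (radialExt u) z ≤
        d * partialT (levelCutoff (obstacleFun φ) ε) z := by
  have h1 := eventually_forall_levelFlux_le b hφs hφ hK hu hbdry ht₁ ht₂ hd
  by_cases ht : t₁ < t₂
  swap
  · exact Eventually.of_forall fun ε z _ hz => absurd (hz.1.trans hz.2) ht
  have hcos : Real.cos t₁ < 1 := by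
    rw [← Real.cos_zero]
    exact Real.cos_lt_cos_of_nonneg_of_le_pi le_rfl (ht.trans ht₂).le ht₁
  have h2 : ∀ᶠ ε in 𝓝 (0 : ℝ), 2 * ε < 1 - Real.cos t₁ := by
    have : ContinuousAt (fun ε : ℝ => 2 * ε) 0 := by fun_prop
    exact this.eventually_lt_const (by linarith)
  filter_upwards [nhdsWithin_le_nhds h1, nhdsWithin_le_nhds h2, self_mem_nhdsWithin]
    with ε hflux hε' hε z hz hzJ
  obtain ⟨-, c, m, hm, hm', h⟩ := levelCutoff_local hφs hφ ht₁ ht₂ hε hε' z hzJ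
  have hrad := fderiv_radialExt_radial
    ((contDiffAt_radialExt hφs hφ hK hu hz.1 hz.2).differentiableAt (by norm_num))
  have hsum := partialX_sum_inner (b := b) (radialExt u) z z.2
  rw [hrad] at hsum
  have hT : partialT (levelCutoff (obstacleFun φ) ε) z = m * Real.sin z.1 := by
    rw [partialT, h]; simp
  have hX : ∀ i, partialX b (levelCutoff (obstacleFun φ) ε) i z =
      c * inner ℝ (b i) z.2 + m * fderiv ℝ (obstacleFun φ) z.2 (b i) := fun i => by
    rw [partialX, h, real_inner_comm]; simp
  have e : flux b (levelCutoff (obstacleFun φ) ε) (radialExt u) z =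
      m * levelFlux b (obstacleFun φ) (fderiv ℝ (radialExt u)) z := by
    have e1 : ∑ i, partialX b (radialExt u) i z * partialX b (levelCutoff (obstacleFun φ) ε) i z =
        c * ∑ i, partialX b (radialExt u) i z * inner ℝ (b i) z.2
        + m * ∑ i, partialX b (radialExt u) i z * fderiv ℝ (obstacleFun φ) z.2 (b i) := by
      simp only [hX, Finset.mul_sum, ← Finset.sum_add_distrib]
      exact Finset.sum_congr rfl fun i _ => by ring
    rw [flux, e1, hsum, hT, levelFlux]
    simp only [energyDensity, partialT, partialX]
    ring
  rw [e, hT]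
  by_cases hm0 : m = 0
  · simp [hm0]
  · obtain ⟨hn, hlt, hle⟩ := hm' hm0
    have := mul_le_mul_of_nonneg_left
      (hflux z ⟨Ioo_subset_Icc_self hzJ, hn⟩ hlt hle) hm
    linarith

end Cutoff

/-! ### Comparing cutoff integrals with integrals over the slices of `Y`. -/

section Slices

variable {φ : S2 → ℝ}

/-- The cross section of `Y` at time `T`, up to a null set at time `0`. -/
def levelSlice (φ : S2 → ℝ) (T : ℝ) : Set S3 := {X | Real.cos T < obstacleFun φ (X : E4)}

variable (hφs : ContMDiff (𝓡 2) 𝓘(ℝ, ℝ) ∞ φ) (hφ : ∀ θ, 0 < φ θ)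
include hφs hφ

theorem isOpen_levelSlice (T : ℝ) : IsOpen (levelSlice φ T) := by
  refine isOpen_lt continuous_const (continuous_iff_continuousAt.2 fun X => ?_)
  exact ContinuousAt.comp (f := fun X : S3 => (X : E4))
    (continuousAt_obstacleFun hφs hφ (ne_zero_of_mem_unit_sphere X))
    continuous_subtype_val.continuousAt

theorem measurable_indicator_levelSlice {T : ℝ} (hT : 0 < T) (hTpi : T < Real.pi)
    {q : ℝ × E4 → ℝ} (hq : ∀ z ∈ coneExterior φ ∩ {z | 0 < z.1}, ContinuousAt q z) {f : S3 → ℝ}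
    (hqf : ∀ z ∈ coneExterior φ ∩ {z | 0 < z.1}, z.1 = T → q z = f (radialProj z.2)) :
    Measurable ((levelSlice φ T).indicator fun X => ENNReal.ofReal (f X)) := by
  have hmem : ∀ X ∈ levelSlice φ T, (T, (X : E4)) ∈ coneExterior φ ∩ {z | 0 < z.1} :=
    fun X hX => ⟨⟨hT.le, hTpi, ne_zero_of_mem_unit_sphere X, hX⟩, hT⟩
  have h1 : ContinuousOn (fun X : S3 => ENNReal.ofReal (f X)) (levelSlice φ T) := by
    have h2 : ContinuousOn (fun X : S3 => ENNReal.ofReal (q (T, (X : E4)))) (levelSlice φ T) := by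
      intro X hX
      refine (ENNReal.continuous_ofReal.continuousAt.comp ?_).continuousWithinAt
      exact ContinuousAt.comp (f := fun X : S3 => (T, (X : E4))) (hq _ (hmem X hX))
        (Continuous.continuousAt (by fun_prop))
    refine h2.congr fun X hX => ?_
    simp only [hqf _ (hmem X hX) rfl, radialProj_coe]
  classical
  rw [← Set.piecewise_eq_indicator]
  exact h1.measurable_piecewise continuousOn_const (isOpen_levelSlice hφs hφ T).measurableSet

theorem levelCutoff_mul_le {T ε : ℝ} (hT : 0 < T) (hTpi : T < Real.pi)
    {q : ℝ × E4 → ℝ} {f : S3 → ℝ}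
    (hqf : ∀ z ∈ coneExterior φ ∩ {z | 0 < z.1}, z.1 = T → q z = f (radialProj z.2))
    (hε : 0 < ε) (x : E4) :
    ENNReal.ofReal (levelCutoff (obstacleFun φ) ε (T, x) * q (T, x)) ≤
      ENNReal.ofReal (annulusBump x) *
        (levelSlice φ T).indicator (fun X => ENNReal.ofReal (f X)) (radialProj x) := by
  by_cases hx : x = 0
  · have : annulusBump x = 0 := annulusBump_eq_zero (by rw [hx]; norm_num)
    rw [levelCutoff]
    simp [this]
  by_cases hz : Real.cos T < obstacleFun φ x
  · have hzW : (T, x) ∈ coneExterior φ ∩ {z | 0 < z.1} := ⟨⟨hT.le, hTpi, hx, hz⟩, hT⟩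
    have hm : radialProj x ∈ levelSlice φ T := by
      change Real.cos T < _
      rwa [obstacleFun_radialProj hx]
    rw [indicator_of_mem hm, ← hqf _ hzW rfl, levelCutoff, ENNReal.ofReal_mul
      (mul_nonneg (annulusBump_nonneg _) (Real.smoothTransition.nonneg _))]
    gcongr
    exact mul_le_of_le_one_right (annulusBump_nonneg _) (Real.smoothTransition.le_one _)
  · have h0 := (levelCutoff_eventuallyEq_zero hφs hφ hε (z := (T, x)) hx
      (by simp only; linarith)).eq_of_nhds
    rw [h0]
    simp

theorem ofReal_integral_levelCutoff_le {T ε t₁ t₂ : ℝ} (ht₁ : 0 < t₁) (ht₂ : t₂ < Real.pi)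
    (hT : T ∈ Ioo t₁ t₂) (hε : 0 < ε) (hε' : 2 * ε < 1 - Real.cos t₁)
    {q : ℝ × E4 → ℝ} (hq : ∀ z ∈ coneExterior φ ∩ {z | 0 < z.1}, ContinuousAt q z)
    (hq0 : ∀ z, 0 ≤ q z) {f : S3 → ℝ}
    (hqf : ∀ z ∈ coneExterior φ ∩ {z | 0 < z.1}, z.1 = T → q z = f (radialProj z.2))
    {c : ℝ≥0∞} (hc : ∀ f : S3 → ℝ≥0∞, Measurable f →
      ∫⁻ x : E4, ENNReal.ofReal (annulusBump x) * f (radialProj x) =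
        c * ∫⁻ X, f X ∂(volume : Measure E4).toSphere) :
    ENNReal.ofReal (∫ x, levelCutoff (obstacleFun φ) ε (T, x) * q (T, x)) ≤
      c * ∫⁻ X in levelSlice φ T, ENNReal.ofReal (f X) ∂(volume : Measure E4).toSphere := by
  have hcut := isCutoff_levelCutoff hφs hφ ht₁ ht₂ hε hε'
  have hT0 := ht₁.trans hT.1
  have hTpi := hT.2.trans ht₂
  rw [ofReal_integral_eq_lintegral_ofReal (hcut.integrable_mul hq hT)
    (ae_of_all _ fun x => mul_nonneg (hcut.nonneg (T, x) hT) (hq0 _)),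
    ← lintegral_indicator (isOpen_levelSlice hφs hφ T).measurableSet,
    ← hc _ (measurable_indicator_levelSlice hφs hφ hT0 hTpi hq hqf)]
  exact lintegral_mono (levelCutoff_mul_le hφs hφ hT0 hTpi hqf hε)

/-- Fatou's lemma as `ε → 0`: at each point of the open slice the cutoff eventually equals the bump.
No bound on `q` near the boundary is required. -/
theorem le_of_eventually_integral_levelCutoff_le {T t₁ t₂ : ℝ} (ht₁ : 0 < t₁) (ht₂ : t₂ < Real.pi)
    (hT : T ∈ Ioo t₁ t₂)
    {q : ℝ × E4 → ℝ} (hq : ∀ z ∈ coneExterior φ ∩ {z | 0 < z.1}, ContinuousAt q z)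
    (hq0 : ∀ z, 0 ≤ q z) {f : S3 → ℝ}
    (hqf : ∀ z ∈ coneExterior φ ∩ {z | 0 < z.1}, z.1 = T → q z = f (radialProj z.2))
    {c : ℝ≥0∞} (hc : ∀ f : S3 → ℝ≥0∞, Measurable f →
      ∫⁻ x : E4, ENNReal.ofReal (annulusBump x) * f (radialProj x) =
        c * ∫⁻ X, f X ∂(volume : Measure E4).toSphere) {C : ℝ≥0∞}
    (hC : ∀ᶠ ε in 𝓝[>] (0 : ℝ),
      ENNReal.ofReal (∫ x, levelCutoff (obstacleFun φ) ε (T, x) * q (T, x)) ≤ C) :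
    c * ∫⁻ X in levelSlice φ T, ENNReal.ofReal (f X) ∂(volume : Measure E4).toSphere ≤ C := by
  have hT0 := ht₁.trans hT.1
  have hTpi := hT.2.trans ht₂
  have hcos : Real.cos t₁ < 1 := by
    rw [← Real.cos_zero]
    exact Real.cos_lt_cos_of_nonneg_of_le_pi le_rfl (hT.1.trans hTpi).le ht₁
  have hsmall : ∀ᶠ ε in 𝓝[>] (0 : ℝ), 0 < ε ∧ 2 * ε < 1 - Real.cos t₁ := by
    have : ContinuousAt (fun ε : ℝ => 2 * ε) 0 := by fun_prop
    filter_upwards [self_mem_nhdsWithin,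
      nhdsWithin_le_nhds (this.eventually_lt_const (u := 1 - Real.cos t₁) (by linarith))]
      with ε h1 h2 using ⟨h1, h2⟩
  have hwithin : Tendsto (fun n : ℕ => 1 / ((n : ℝ) + 1)) atTop (𝓝[>] 0) :=
    tendsto_nhdsWithin_iff.2 ⟨tendsto_one_div_add_atTop_nhds_zero_nat,
      Eventually.of_forall fun n => mem_Ioi.2 (by positivity)⟩
  obtain ⟨N, hN⟩ := eventually_atTop.1
    (hwithin.eventually (hsmall.and hC))
  -- The shift by `N` makes every term, not just late ones, an admissible cutoff parameter.
  set e : ℕ → ℝ := fun n => 1 / (((n + N : ℕ) : ℝ) + 1) with he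
  have hgood : ∀ n, (0 < e n ∧ 2 * e n < 1 - Real.cos t₁) ∧
      ENNReal.ofReal (∫ x, levelCutoff (obstacleFun φ) (e n) (T, x) * q (T, x)) ≤ C :=
    fun n => hN (n + N) (Nat.le_add_left _ _)
  have hlim : Tendsto e atTop (𝓝 0) :=
    (tendsto_add_atTop_iff_nat (f := fun n : ℕ => 1 / ((n : ℝ) + 1)) N).2
      tendsto_one_div_add_atTop_nhds_zero_nat
  have hcut := fun n => isCutoff_levelCutoff hφs hφ ht₁ ht₂ (hgood n).1.1 (hgood n).1.2
  rw [← lintegral_indicator (isOpen_levelSlice hφs hφ T).measurableSet,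
    ← hc _ (measurable_indicator_levelSlice hφs hφ hT0 hTpi hq hqf)]
  calc ∫⁻ x : E4, ENNReal.ofReal (annulusBump x) *
        (levelSlice φ T).indicator (fun X => ENNReal.ofReal (f X)) (radialProj x)
      ≤ ∫⁻ x : E4, liminf (fun n => ENNReal.ofReal
          (levelCutoff (obstacleFun φ) (e n) (T, x) * q (T, x))) atTop := by
        refine lintegral_mono fun x => ?_
        by_cases hx : x = 0
        · have : annulusBump x = 0 := annulusBump_eq_zero (by rw [hx]; norm_num)
          simp [this]
        by_cases hm : radialProj x ∈ levelSlice φ T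
        · have hz : Real.cos T < obstacleFun φ x := by
            rw [← obstacleFun_radialProj hx]; exact hm
          have hzW : (T, x) ∈ coneExterior φ ∩ {z | 0 < z.1} := ⟨⟨hT0.le, hTpi, hx, hz⟩, hT0⟩
          simp only [indicator_of_mem hm]
          rw [← hqf _ hzW rfl, ← ENNReal.ofReal_mul (annulusBump_nonneg _)]
          refine le_of_eq (Tendsto.liminf_eq ?_).symm
          refine tendsto_const_nhds.congr' ?_
          have h2 : ∀ᶠ n in atTop, e n < (obstacleFun φ x - Real.cos T) / 2 :=
            hlim.eventually_lt_const (by linarith)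
          filter_upwards [h2] with n hn
          rw [(levelCutoff_eventuallyEq_bump hφs hφ (hgood n).1.1 (z := (T, x)) hx
            (by simp only; linarith)).eq_of_nhds]
        · simp [indicator_of_notMem hm]
    _ ≤ liminf (fun n => ∫⁻ x : E4, ENNReal.ofReal
          (levelCutoff (obstacleFun φ) (e n) (T, x) * q (T, x))) atTop := by
        refine lintegral_liminf_le fun n => ENNReal.measurable_ofReal.comp (Continuous.measurable ?_)
        exact continuous_slice (q := fun z => levelCutoff (obstacleFun φ) (e n) z * q z)
          ((hcut n).continuousAt_mul hq) hT
    _ ≤ C := by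
        refine (liminf_le_of_le ⟨0, by simp⟩ fun b hb => ?_)
        obtain ⟨n, hn⟩ := hb.exists
        refine hn.trans ?_
        rw [← ofReal_integral_eq_lintegral_ofReal ((hcut n).integrable_mul hq hT)
          (ae_of_all _ fun x => mul_nonneg ((hcut n).nonneg (T, x) hT) (hq0 _))]
        exact (hgood n).2

end Slices

/-! ### The estimate between two positive times. -/

section EnergyEstimate

variable {φ : S2 → ℝ} {u F : ℝ × S3 → ℝ} {K : Set E3}
  (hφs : ContMDiff (𝓡 2) 𝓘(ℝ, ℝ) ∞ φ) (hφ : ∀ θ, 0 < φ θ)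
  (hK : K = {x | ∃ (r : ℝ) (θ : S2), 0 ≤ r ∧ r ≤ φ θ ∧ x = r • (θ : E3)})

theorem L2Norm_eq_of_ae {A B : Set S3} (h : A =ᵐ[(volume : Measure E4).toSphere] B) (f : S3 → ℝ) :
    L2Norm A f =
      (∫⁻ X in B, ENNReal.ofReal (f X ^ 2) ∂(volume : Measure E4).toSphere) ^ (1 / 2 : ℝ) := by
  rw [L2Norm, Measure.restrict_congr_set h,
    eLpNorm_eq_lintegral_rpow_enorm_toReal (by norm_num) (by norm_num)]
  simp only [ENNReal.toReal_ofNat]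
  congr 1
  refine lintegral_congr fun X => ?_
  rw [← ofReal_norm, ENNReal.ofReal_rpow_of_nonneg (norm_nonneg _) (by norm_num),
    Real.rpow_ofNat, Real.norm_eq_abs, sq_abs]

theorem ofReal_sqrt_eq {a : ℝ} (ha : 0 ≤ a) :
    ENNReal.ofReal √a = ENNReal.ofReal a ^ (1 / 2 : ℝ) := by
  rw [Real.sqrt_eq_rpow, ENNReal.ofReal_rpow_of_nonneg ha (by norm_num)]

include hφ hK

theorem exteriorSlice_eq {T : ℝ} (hT : 0 < T) (hTpi : T < Real.pi) :
    exteriorSlice K T = levelSlice φ T := by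
  ext X
  exact mem_exterior_iff hφ hK hT.le hTpi X (Or.inl hT)

include hφs

theorem exteriorSlice_zero_ae_eq :
    exteriorSlice K 0 =ᵐ[(volume : Measure E4).toSphere] levelSlice φ 0 := by
  filter_upwards [ae_sphere_obstacleFun_ne_one hφs hφ] with X hX
  exact propext (mem_exterior_iff hφ hK le_rfl Real.pi_pos X (Or.inr hX))

theorem L2Norm_le_of_pos
    (hu : ContMDiffOn (𝓘(ℝ, ℝ).prod (𝓡 3)) 𝓘(ℝ, ℝ) 2 u (exteriorClosure K))
    (hbdry : ∀ p ∈ exteriorBoundary K, u p = 0)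
    (hF : ∀ p ∈ exterior K, F p = waveOp u p) {T₁ T₂ : ℝ} (hT₁ : 0 < T₁) (hT : T₁ ≤ T₂)
    (hT₂ : T₂ < Real.pi) :
    L2Norm (exteriorSlice K T₂) (fun X => normDeriv u (T₂, X)) ≤
      L2Norm (exteriorSlice K T₁) (fun X => normDeriv u (T₁, X)) +
        ∫⁻ S in Ioc T₁ T₂, L2Norm (exteriorSlice K S) (fun X => F (S, X)) := by
  set b := EuclideanSpace.basisFun (Fin 4) ℝ
  obtain ⟨c, hc0, hctop, hc⟩ := exists_lintegral_annulusBump_mul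
  -- The open interval `(t₁, t₂)` contains `[T₁, T₂]` and stays away from 0 and `π`.
  set t₁ := T₁ / 2 with ht₁def
  set t₂ := (T₂ + Real.pi) / 2 with ht₂def
  have ht₁ : 0 < t₁ := by positivity
  have ht₂ : t₂ < Real.pi := by linarith
  have hJ : Icc T₁ T₂ ⊆ Ioo t₁ t₂ := fun S hS => ⟨by linarith [hS.1], by linarith [hS.2]⟩
  set W := coneExterior φ ∩ {z : ℝ × E4 | 0 < z.1} with hW
  have hv : ∀ z ∈ W, ContDiffAt ℝ 2 (radialExt u) z := fun z hz =>
    contDiffAt_radialExt hφs hφ hK hu hz.1 hz.2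
  have hrad : ∀ z ∈ W, fderiv ℝ (radialExt u) z (0, z.2) = 0 := fun z hz =>
    fderiv_radialExt_radial ((hv z hz).differentiableAt (by norm_num))
  have hEc : ∀ z ∈ W, ContinuousAt (energyDensity b (radialExt u)) z := fun z hz =>
    (contDiffAt_energyDensity (hv z hz)).continuousAt
  have hEf : ∀ T, ∀ z ∈ W, z.1 = T →
      energyDensity b (radialExt u) z = normDeriv u (T, radialProj z.2) ^ 2 := by
    rintro T z hz rfl
    exact (normDeriv_sq_eq_energyDensity hφs hφ hK b hu hz.1 hz.2).symm
  have hFc : ∀ z ∈ W, ContinuousAt (fun z => conicalWaveOp b (radialExt u) z ^ 2) z := fun z hz =>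
    (continuousAt_conicalWaveOp (hv z hz)).pow 2
  have hFf : ∀ T, ∀ z ∈ W, z.1 = T →
      conicalWaveOp b (radialExt u) z ^ 2 = F (T, radialProj z.2) ^ 2 := by
    rintro T z hz rfl
    rw [hF _ (mem_exterior_of_mem_cone hφ hK hz.1),
      waveOp_eq_conicalWaveOp hφs hφ hK b hu hz.1 hz.2]
  have hL2 : ∀ S ∈ Icc T₁ T₂, ∀ f : S3 → ℝ, L2Norm (exteriorSlice K S) f =
      (∫⁻ X in levelSlice φ S, ENNReal.ofReal (f X ^ 2) ∂(volume : Measure E4).toSphere)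
        ^ (1 / 2 : ℝ) := fun S hS f => by
    rw [exteriorSlice_eq hφ hK (hT₁.trans_le hS.1) (hS.2.trans_lt hT₂)]
    exact L2Norm_eq_of_ae (ae_eq_refl _) f
  set M := ∫ x, annulusBump x with hM
  have hM0 : 0 ≤ M := integral_nonneg annulusBump_nonneg
  have hcos : Real.cos t₁ < 1 := by
    rw [← Real.cos_zero]
    exact Real.cos_lt_cos_of_nonneg_of_le_pi le_rfl (by linarith) ht₁
  have hsmall : ∀ᶠ ε in 𝓝[>] (0 : ℝ), 0 < ε ∧ 2 * ε < 1 - Real.cos t₁ := by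
    have : ContinuousAt (fun ε : ℝ => 2 * ε) 0 := by fun_prop
    filter_upwards [self_mem_nhdsWithin,
      nhdsWithin_le_nhds (this.eventually_lt_const (u := 1 - Real.cos t₁) (by linarith))]
      with ε h1 h2 using ⟨h1, h2⟩
  set R := L2Norm (exteriorSlice K T₁) (fun X => normDeriv u (T₁, X)) +
        ∫⁻ S in Ioc T₁ T₂, L2Norm (exteriorSlice K S) (fun X => F (S, X)) with hR
  set k : ℝ≥0∞ := c ^ (1 / 2 : ℝ) with hk
  have hk0 : k ≠ 0 := by simp [hk, hc0, hctop]
  have hktop : k ≠ ⊤ := by simp [hk, hc0, hctop]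
  have key : ∀ r : ℝ, 0 < r → k * L2Norm (exteriorSlice K T₂) (fun X => normDeriv u (T₂, X)) ≤
      k * R + ENNReal.ofReal (r * (1 + M)) := by
    intro r hr
    have hδ : 0 < r ^ 2 := by positivity
    rw [hL2 T₂ (right_mem_Icc.2 hT), hk, ← ENNReal.mul_rpow_of_nonneg _ _ (by norm_num), ← hk]
    rw [one_div, ENNReal.rpow_inv_le_iff (by norm_num)]
    refine le_of_eventually_integral_levelCutoff_le hφs hφ ht₁ ht₂
      (hJ (right_mem_Icc.2 hT)) hEc (fun z => energyDensity_nonneg z) (hEf T₂) hc ?_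
    -- The choice `d = 2 r²`, with `δ = r²`, makes the coefficient `d / (2√δ)` equal to `r`. Of the
    -- total error `r (1 + M)`, the term `r` comes from `√(E + r²) ≤ √E + r` and the term `r M` from
    -- the mass of the cutoff.
    filter_upwards [hsmall, eventually_flux_levelCutoff_le hφs hφ b hK hu hbdry ht₁ ht₂
      (d := 2 * r ^ 2) (by positivity)] with ε ⟨hε, hε'⟩ hflux
    set κ := levelCutoff (obstacleFun φ) ε
    have hcut : IsCutoff κ (Ioo t₁ t₂) W 2 := isCutoff_levelCutoff hφs hφ ht₁ ht₂ hε hε'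
    rw [← ENNReal.rpow_inv_le_iff (by norm_num), ← one_div]
    change ENNReal.ofReal (energy volume b κ (radialExt u) T₂) ^ (1 / 2 : ℝ) ≤ _
    have hE₁ := energy_nonneg (μ := volume) (b := b) (v := radialExt u) hcut
      (hJ (left_mem_Icc.2 hT))
    have hE₂ := energy_nonneg (μ := volume) (b := b) (v := radialExt u) hcut
      (hJ (right_mem_Icc.2 hT))
    rw [← ofReal_sqrt_eq hE₂]
    have h1 := sqrt_energy_le (μ := volume) hcut hv hrad (by positivity) hflux hδ hT hJ
    rw [Real.sqrt_sq hr.le] at h1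
    have h2 : √(energy volume b κ (radialExt u) T₂) ≤ √(energy volume b κ (radialExt u) T₂ + r ^ 2) :=
      Real.sqrt_le_sqrt (by linarith)
    have h3 : √(energy volume b κ (radialExt u) T₁ + r ^ 2) ≤
        √(energy volume b κ (radialExt u) T₁) + r := by
      refine Real.sqrt_le_iff.2 ⟨by positivity, ?_⟩
      have := Real.sq_sqrt hE₁
      nlinarith [Real.sqrt_nonneg (energy volume b κ (radialExt u) T₁)]
    have h4 : (∫ x, κ (T₂, x)) ≤ M := by
      refine integral_mono ?_ ?_ fun x => ?_
      · exact integrable_slice (fun z hz => (hcut.contDiffAt z hz).continuousAt) hcut.eq_zero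
          (hJ (right_mem_Icc.2 hT))
      · exact contDiff_annulusBump.continuous.integrable_of_hasCompactSupport
          hasCompactSupport_annulusBump
      · exact mul_le_of_le_one_right (annulusBump_nonneg _) (Real.smoothTransition.le_one _)
    have h5 : 0 ≤ ∫ x, κ (T₁, x) :=
      integral_nonneg fun x => hcut.nonneg (T₁, x) (hJ (left_mem_Icc.2 hT))
    have h6 : 2 * r ^ 2 / (2 * r) * ((∫ x, κ (T₂, x)) - ∫ x, κ (T₁, x)) ≤ r * M := by
      rw [show 2 * r ^ 2 / (2 * r) = r by field_simp]
      exact mul_le_mul_of_nonneg_left (by linarith) hr.le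
    have h7 : √(energy volume b κ (radialExt u) T₂) ≤ √(energy volume b κ (radialExt u) T₁)
        + (∫ S in T₁..T₂, sourceNorm volume b κ (radialExt u) S) + r * (1 + M) := by linarith
    have h8 : ENNReal.ofReal √(energy volume b κ (radialExt u) T₁) ≤
        k * L2Norm (exteriorSlice K T₁) (fun X => normDeriv u (T₁, X)) := by
      rw [hL2 T₁ (left_mem_Icc.2 hT), hk, ← ENNReal.mul_rpow_of_nonneg _ _ (by norm_num),
        ofReal_sqrt_eq hE₁]
      refine ENNReal.rpow_le_rpow ?_ (by norm_num)
      exact ofReal_integral_levelCutoff_le hφs hφ ht₁ ht₂ (hJ (left_mem_Icc.2 hT)) hε hε' hEc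
        (fun z => energyDensity_nonneg z) (hEf T₁) hc
    have h9 : ENNReal.ofReal (∫ S in T₁..T₂, sourceNorm volume b κ (radialExt u) S) ≤
        k * ∫⁻ S in Ioc T₁ T₂, L2Norm (exteriorSlice K S) (fun X => F (S, X)) := by
      rw [intervalIntegral.integral_of_le hT, ofReal_integral_eq_lintegral_ofReal
        (((continuousOn_sourceNorm hcut hv).mono hJ).integrableOn_Icc.mono_set Ioc_subset_Icc_self)
        (ae_of_all _ fun S => Real.sqrt_nonneg _), ← lintegral_const_mul' _ _ hktop]
      refine setLIntegral_mono' measurableSet_Ioc fun S hS => ?_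
      have hS' := Ioc_subset_Icc_self hS
      have h10 : 0 ≤ ∫ x, κ (S, x) * conicalWaveOp b (radialExt u) (S, x) ^ 2 :=
        integral_nonneg fun x => mul_nonneg (hcut.nonneg (S, x) (hJ hS')) (sq_nonneg _)
      rw [hL2 S hS', hk, ← ENNReal.mul_rpow_of_nonneg _ _ (by norm_num), sourceNorm,
        ofReal_sqrt_eq h10]
      refine ENNReal.rpow_le_rpow ?_ (by norm_num)
      exact ofReal_integral_levelCutoff_le hφs hφ ht₁ ht₂ (hJ hS') hε hε' hFc
        (fun z => sq_nonneg _) (hFf S) hc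
    calc ENNReal.ofReal √(energy volume b κ (radialExt u) T₂)
        ≤ ENNReal.ofReal (√(energy volume b κ (radialExt u) T₁)
          + (∫ S in T₁..T₂, sourceNorm volume b κ (radialExt u) S) + r * (1 + M)) :=
          ENNReal.ofReal_le_ofReal h7
      _ ≤ ENNReal.ofReal √(energy volume b κ (radialExt u) T₁)
          + ENNReal.ofReal (∫ S in T₁..T₂, sourceNorm volume b κ (radialExt u) S)
          + ENNReal.ofReal (r * (1 + M)) :=
          ENNReal.ofReal_add_le.trans (by gcongr; exact ENNReal.ofReal_add_le)
      _ ≤ k * R + ENNReal.ofReal (r * (1 + M)) := by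
          rw [hR, mul_add k]
          exact add_le_add_left (add_le_add h8 h9) _
  have hfin : k * L2Norm (exteriorSlice K T₂) (fun X => normDeriv u (T₂, X)) ≤ k * R := by
    refine ENNReal.le_of_forall_pos_le_add fun s hs _ => ?_
    have h1 := key (s / (1 + M)) (div_pos (NNReal.coe_pos.2 hs) (by linarith))
    rwa [div_mul_cancel₀ _ (by linarith : 1 + M ≠ 0), ENNReal.ofReal_coe_nnreal] at h1
  exact (ENNReal.mul_le_mul_iff_right hk0 hktop).1 hfin

end EnergyEstimate

/-! ### Letting the initial time tend to 0. -/

section InitialTime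

variable {φ : S2 → ℝ} {u F : ℝ × S3 → ℝ} {K : Set E3}
  (hφs : ContMDiff (𝓡 2) 𝓘(ℝ, ℝ) ∞ φ) (hφ : ∀ θ, 0 < φ θ)
  (hK : K = {x | ∃ (r : ℝ) (θ : S2), 0 ≤ r ∧ r ≤ φ θ ∧ x = r • (θ : E3)})
include hφs hφ hK

/-- Near a point of `Y ∪ ∂Y`, the function `|u'|²` on `Y` extends continuously. -/
theorem exists_normDeriv_sq_extension
    (hu : ContMDiffOn (𝓘(ℝ, ℝ).prod (𝓡 3)) 𝓘(ℝ, ℝ) 2 u (exteriorClosure K))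
    {p : ℝ × E4} (hp : p ∈ coneClosure K) :
    ∃ N : ℝ × E4 → ℝ, ContinuousWithinAt N (coneClosure K) p ∧
      ∀ᶠ z in 𝓝 p, ∀ X : S3, z = (z.1, (X : E4)) → z ∈ coneExterior φ →
        normDeriv u (z.1, X) ^ 2 = N z := by
  obtain ⟨L, hLc, hL⟩ := exists_hasFDerivWithinAt hu hp
  set b := EuclideanSpace.basisFun (Fin 4) ℝ
  refine ⟨fun z => L z (1, 0) ^ 2 + ∑ i, L z (0, b i) ^ 2, ?_, ?_⟩
  · have hc := fun y : ℝ × E4 => hLc.clm_apply (continuousWithinAt_const (b := y))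
    exact ((hc _).pow 2).add (tendsto_finsetSum _ fun i _ => (hc _).pow 2)
  · rw [eventually_nhdsWithin_iff] at hL
    filter_upwards [hL] with z hz X hX hzW
    have h1 := hz (coneExterior_subset hφ hK hzW)
    rw [hX] at h1 hzW ⊢
    exact normDeriv_sq_eq hφs hφ hK b hzW h1

/-- The continuous extension of `|u'|²` is bounded near each point of the closure, and compactness
over `[0, T]` patches the local bounds together. -/
theorem exists_normDeriv_sq_le
    (hu : ContMDiffOn (𝓘(ℝ, ℝ).prod (𝓡 3)) 𝓘(ℝ, ℝ) 2 u (exteriorClosure K))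
    {T : ℝ} (hT : T < Real.pi) :
    ∃ C : ℝ, ∀ S ∈ Icc 0 T, ∀ X ∈ levelSlice φ S, normDeriv u (S, X) ^ 2 ≤ C := by
  have hcomp : IsCompact (closure (exterior K) ∩ Icc 0 T ×ˢ (univ : Set S3)) :=
    (isCompact_Icc.prod isCompact_univ).inter_left isClosed_closure
  have hmem : ∀ S ∈ Icc 0 T, ∀ X ∈ levelSlice φ S, (S, (X : E4)) ∈ coneExterior φ :=
    fun S hS X hX => ⟨hS.1, hS.2.trans_lt hT, ne_zero_of_mem_unit_sphere X, hX⟩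
  have key : ∃ C : ℝ, ∀ q ∈ closure (exterior K) ∩ Icc 0 T ×ˢ (univ : Set S3),
      q.2 ∈ levelSlice φ q.1 → normDeriv u q ^ 2 ≤ C := by
    refine hcomp.induction_on
      (p := fun s => ∃ C : ℝ, ∀ q ∈ s, q.2 ∈ levelSlice φ q.1 → normDeriv u q ^ 2 ≤ C)
      ⟨0, by simp⟩ ?_ ?_ ?_
    · rintro s t hst ⟨C, hC⟩
      exact ⟨C, fun q hq => hC q (hst hq)⟩
    · rintro s t ⟨C, hC⟩ ⟨C', hC'⟩
      refine ⟨max C C', ?_⟩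
      rintro q (hq | hq) h
      · exact (hC q hq h).trans (le_max_left _ _)
      · exact (hC' q hq h).trans (le_max_right _ _)
    · intro q hq
      have hqD : (q.1, (q.2 : E4)) ∈ coneClosure K :=
        ⟨ne_zero_of_mem_unit_sphere _, by
          simp only [radialProj_coe]
          exact ⟨hq.1, ⟨hq.2.1.1, hq.2.1.2.trans_lt hT⟩, mem_univ _⟩⟩
      obtain ⟨N, hNc, hN⟩ := exists_normDeriv_sq_extension hφs hφ hK hu hqD
      have h1 := hNc.eventually_lt_const (lt_add_one (N (q.1, (q.2 : E4))))
      rw [eventually_nhdsWithin_iff] at h1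
      have hc : Tendsto (fun y : ℝ × S3 => (y.1, (y.2 : E4))) (𝓝 q) (𝓝 (q.1, (q.2 : E4))) :=
        Continuous.tendsto (by fun_prop) q
      refine ⟨{y | y.2 ∈ levelSlice φ y.1 → y ∈ Icc 0 T ×ˢ (univ : Set S3) →
        normDeriv u y ^ 2 ≤ N (q.1, (q.2 : E4)) + 1} ∩ Icc 0 T ×ˢ (univ : Set S3), ?_,
        N (q.1, (q.2 : E4)) + 1, fun y hy h => hy.1 h hy.2⟩
      refine inter_mem (nhdsWithin_le_nhds ?_)
        (mem_of_superset self_mem_nhdsWithin inter_subset_right)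
      filter_upwards [hc.eventually h1, hc.eventually hN] with y hy1 hy2 hy hyT
      have hyW := hmem y.1 hyT.1 y.2 hy
      have h3 := hy2 y.2 rfl hyW
      have h4 := hy1 (coneExterior_subset hφ hK hyW)
      exact h3.le.trans h4.le
  obtain ⟨C, hC⟩ := key
  refine ⟨C, fun S hS X hX => hC (S, X) ⟨subset_closure ?_, hS, mem_univ _⟩ hX⟩
  have := mem_exterior_of_mem_cone hφ hK (hmem S hS X hX)
  simpa only [radialProj_coe] using this

/-- Dominated convergence. For almost every `X`, either `γ(X) < 1` and `X` is outside the slices at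
all small times, or `γ(X) > 1` and `X` is in every slice, where `|u'|²` is continuous down to time
0. -/
theorem tendsto_lintegral_normDeriv_sq
    (hu : ContMDiffOn (𝓘(ℝ, ℝ).prod (𝓡 3)) 𝓘(ℝ, ℝ) 2 u (exteriorClosure K)) :
    Tendsto (fun T => ∫⁻ X in levelSlice φ T, ENNReal.ofReal (normDeriv u (T, X) ^ 2)
        ∂(volume : Measure E4).toSphere) (𝓝[>] 0)
      (𝓝 (∫⁻ X in levelSlice φ 0, ENNReal.ofReal (normDeriv u (0, X) ^ 2)
        ∂(volume : Measure E4).toSphere)) := by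
  set b := EuclideanSpace.basisFun (Fin 4) ℝ
  simp only [← lintegral_indicator (isOpen_levelSlice hφs hφ _).measurableSet]
  obtain ⟨C, hC⟩ := exists_normDeriv_sq_le hφs hφ hK hu (T := 1) (by linarith [Real.pi_gt_three])
  have hev : ∀ᶠ T in 𝓝[>] (0 : ℝ), 0 < T ∧ T < 1 := by
    filter_upwards [Ioo_mem_nhdsGT (zero_lt_one (α := ℝ))] with T hT using hT
  refine tendsto_lintegral_filter_of_dominated_convergence (fun _ => ENNReal.ofReal C) ?_ ?_ ?_ ?_
  · filter_upwards [hev] with T hT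
    refine measurable_indicator_levelSlice hφs hφ hT.1 (by linarith [Real.pi_gt_three, hT.2])
      (q := energyDensity b (radialExt u)) ?_ ?_
    · exact fun z hz => (contDiffAt_energyDensity
        (contDiffAt_radialExt hφs hφ hK hu hz.1 hz.2)).continuousAt
    · rintro z hz rfl
      exact (normDeriv_sq_eq_energyDensity hφs hφ hK b hu hz.1 hz.2).symm
  · filter_upwards [hev] with T hT
    refine ae_of_all _ fun X => indicator_le (g := fun _ => ENNReal.ofReal C) (fun X hX => ?_) X
    exact ENNReal.ofReal_le_ofReal (hC T ⟨hT.1.le, hT.2.le⟩ X hX)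
  · rw [lintegral_const]
    exact ENNReal.mul_ne_top ENNReal.ofReal_ne_top (measure_ne_top _ _)
  · filter_upwards [ae_sphere_obstacleFun_ne_one hφs hφ] with X hX
    rcases hX.lt_or_gt with h | h
    · have h1 : X ∉ levelSlice φ 0 := by
        simp only [levelSlice, mem_ofPred_eq, Real.cos_zero, not_lt]
        exact h.le
      rw [indicator_of_notMem h1]
      refine tendsto_const_nhds.congr' ?_
      have h2 : ∀ᶠ T in 𝓝 (0 : ℝ), obstacleFun φ (X : E4) < Real.cos T :=
        Real.continuous_cos.continuousAt.eventually_const_lt (by rwa [Real.cos_zero])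
      filter_upwards [nhdsWithin_le_nhds h2] with T hT
      rw [indicator_of_notMem]
      simp only [levelSlice, mem_ofPred_eq, not_lt]
      exact hT.le
    · have hm : ∀ T : ℝ, X ∈ levelSlice φ T := fun T => (Real.cos_le_one T).trans_lt h
      simp only [indicator_of_mem (hm _)]
      refine (ENNReal.continuous_ofReal.tendsto _).comp ?_
      have hmem : ∀ T : ℝ, 0 ≤ T → T < 1 → (T, (X : E4)) ∈ coneExterior φ := fun T h0 h1 =>
        ⟨h0, by linarith [Real.pi_gt_three], ne_zero_of_mem_unit_sphere X, hm T⟩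
      have h0 := hmem 0 le_rfl one_pos
      obtain ⟨N, hNc, hN⟩ := exists_normDeriv_sq_extension hφs hφ hK hu
        (coneExterior_subset hφ hK h0)
      have e0 := hN.self_of_nhds X rfl h0
      simp only at e0
      rw [e0]
      have hc : Tendsto (fun T : ℝ => (T, (X : E4))) (𝓝 0) (𝓝 (0, (X : E4))) :=
        Continuous.tendsto (by fun_prop) 0
      have hc' : Tendsto (fun T : ℝ => (T, (X : E4))) (𝓝[>] 0)
          (𝓝[coneClosure K] (0, (X : E4))) := by
        refine tendsto_nhdsWithin_iff.2 ⟨hc.mono_left nhdsWithin_le_nhds, ?_⟩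
        filter_upwards [hev] with T hT
        exact coneExterior_subset hφ hK (hmem T hT.1.le hT.2)
      refine (hNc.tendsto.comp hc').congr' ?_
      filter_upwards [hev, (hc.mono_left nhdsWithin_le_nhds).eventually hN] with T hT hNT
      exact (hNT X rfl (hmem T hT.1.le hT.2)).symm

/-- Pass to the limit `S → 0` in the bound from time `S`; the source integral over `(S, T]` is at
most the one over `(0, T]`, so no regularity of `F` at time 0 is needed. -/
theorem energy_estimate
    (hu : ContMDiffOn (𝓘(ℝ, ℝ).prod (𝓡 3)) 𝓘(ℝ, ℝ) 2 u (exteriorClosure K))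
    (hbdry : ∀ p ∈ exteriorBoundary K, u p = 0)
    (hF : ∀ p ∈ exterior K, F p = waveOp u p) {T : ℝ} (hT0 : 0 < T) (hTpi : T < Real.pi) :
    L2Norm (exteriorSlice K T) (fun X => normDeriv u (T, X)) ≤
      L2Norm (exteriorSlice K 0) (fun X => normDeriv u (0, X)) +
        ∫⁻ S in Ioo 0 T, L2Norm (exteriorSlice K S) (fun X => F (S, X)) := by
  rw [L2Norm_eq_of_ae (exteriorSlice_zero_ae_eq hφs hφ hK), setLIntegral_congr Ioo_ae_eq_Ioc]
  have h1 := ((ENNReal.continuous_rpow_const (y := 1 / 2)).tendsto _).comp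
    (tendsto_lintegral_normDeriv_sq hφs hφ hK hu)
  refine ge_of_tendsto (h1.add_const _) ?_
  filter_upwards [Ioo_mem_nhdsGT hT0] with S hS
  refine (L2Norm_le_of_pos hφs hφ hK hu hbdry hF hS.1 hS.2.le hTpi).trans ?_
  rw [L2Norm_eq_of_ae (B := levelSlice φ S)
    (Eq.eventuallyEq (exteriorSlice_eq hφ hK hS.1 (hS.2.trans hTpi)))]
  exact add_le_add_right (lintegral_mono_set (Ioc_subset_Ioc_left hS.1.le)) _

end InitialTime

end EinsteinDiamond

end

theorem theorem3p1 (K : Set EinsteinDiamond.E3) (hK : EinsteinDiamond.StrictlyStarShaped K)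
    (u F : ℝ × EinsteinDiamond.S3 → ℝ)
    (hu : ContMDiffOn (𝓘(ℝ, ℝ).prod (𝓡 3)) 𝓘(ℝ, ℝ) 2 u (EinsteinDiamond.exteriorClosure K))
    (hbdry : ∀ p ∈ EinsteinDiamond.exteriorBoundary K, u p = 0)
    (hF : ∀ p ∈ EinsteinDiamond.exterior K, F p = EinsteinDiamond.waveOp u p)
    (T : ℝ) (hT0 : 0 < T) (hTpi : T < Real.pi) :
    EinsteinDiamond.L2Norm (EinsteinDiamond.exteriorSlice K T)
        (fun X => EinsteinDiamond.normDeriv u (T, X)) ≤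
      EinsteinDiamond.L2Norm (EinsteinDiamond.exteriorSlice K 0)
          (fun X => EinsteinDiamond.normDeriv u (0, X)) +
        ∫⁻ S in Ioo 0 T, EinsteinDiamond.L2Norm (EinsteinDiamond.exteriorSlice K S)
          (fun X => F (S, X)) := by
  obtain ⟨φ, hφs, hφ, hKφ⟩ := hK
  exact EinsteinDiamond.energy_estimate hφs hφ hKφ hu hbdry hF hT0 hTpi
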